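/- A strict partition is a finite sequence $\lambda=(\lambda_1>\lambda_2>\dots>\lambda_{\ell}>0)$ of positive integers (possibly empty); $\ell(\lambda)=\ell$ is its length and $|\lambda|=\sum_i\lambda_i$. Its shifted Young diagram is $D'(\lambda)=\{(i,j)\in\mathbb Z^2: 1\le i\le\ell(\lambda),\ i\le j\le\lambda_i+i-1\}$. For strict partitions $\lambda,\mu$ write $\mu\subset\lambda$ if $D'(\mu)\subseteq D'(\lambda)$ (equality allowed). In that case a standard shifted tableau of shape $\lambda/\mu$ is a bijection $T:D'(\lambda)\setminus D'(\mu)\to\{1,\dots,|\lambda|-|\mu|\}$ with $T(i,j)<T(i+1,j)$ and $T(i,j)<T(i,j+1)$ whenever both boxes lie in $D'(\lambda)\setminus D'(\mu)$; let $g_{\lambda/\mu}$ be the number of these tableaux. For a skew-symmetric $2n\times 2n$ matrix $A=(a_{ij})$ let $$\operatorname{Pf}(A)=\sum_{\omega}\operatorname{sgn}(\omega)\prod_{i=1}^n a_{\omega(2i-1)\,\omega(2i)},$$ the sum being over the permutations $\omega$ of $\{1,\dots,2n\}$ with $\omega(2i-1)<\omega(2i)$ for all $i$ and $\omega(1)<\omega(3)<\dots<\omega(2n-1)$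 (so $\operatorname{Pf}=1$ for $n=0$). For non-negative integers $x_1,\dots,x_k$, at most one of which is zero, let $X(x_1,\dots,x_k)$ be the skew-symmetric $k\times k$ matrix with entries $\frac{x_i-x_j}{x_i+x_j}\cdot\frac1{x_i!\,x_j!}$ (diagonal entries equal to $0$), and let $Y(x_1,\dots,x_k;\mu)$ be the $k\times\ell(\mu)$ matrix with entries $\frac{1}{(x_i-\mu_{\ell(\mu)+1-j})!}$, where $\frac1{m!}=0$ for $m<0$. **Theorem.** Let $\lambda,\mu$ be strict partitions with $\mu\subset\lambda$. Put $(x_1,\dots,x_k)=(\lambda_1,\dots,\lambda_{\ell(\lambda)})$ if $\ell(\lambda)+\ell(\mu)$ is even, and $(x_1,\dots,x_k)=(\lambda_1,\dots,\lambda_{\ell(\lambda)},0)$ if $\ell(\lambda)+\ell(\mu)$ is odd, and let $$A_{\lambda/\mu}=\begin{pmatrix}X(x_1,\dots,x_k)&Y(x_1,\dots,x_k;\mu)\\-Y(x_1,\dots,x_k;\mu)^t&0\end{pmatrix}.$$ Then $$g_{\lambda/\mu}=(|\lambda|-|\mu|)!\,\operatorname{Pf}(A_{\lambda/\mu}).$$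 -/

import Mathlib

open scoped Nat

/-- A strict partition `λ₁ > λ₂ > … > λ_ℓ > 0`, given by the list of its non-zero parts. -/
@[ext]
structure StrictPartition where
  /-- the non-zero parts, in decreasing order -/
  parts : List ℕ
  strict : parts.Pairwise (· > ·)
  pos : ∀ x ∈ parts, 0 < x

namespace StrictPartition

/-- The length `ℓ(λ)`, that is, the number of non-zero parts. -/
def length (lam : StrictPartition) : ℕ := lam.parts.length

/-- The size `|λ|`, that is, the sum of the parts. -/
def size (lam : StrictPartition) : ℕ := lam.parts.sum

/-- The `i`-th part, counted from `0`; it is `0` for `i ≥ ℓ(λ)`. -/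
def part (lam : StrictPartition) (i : ℕ) : ℕ := lam.parts.getD i 0

/-- The shifted Young diagram. Rows and columns are counted from `0`, so that row `i`
consists of the `λ_i` boxes `(i, i), …, (i, i + λ_i - 1)`. -/
def shiftedDiagram (lam : StrictPartition) : Set (ℕ × ℕ) :=
  {b | b.1 < lam.length ∧ b.1 ≤ b.2 ∧ b.2 < b.1 + lam.part b.1}

/-- The skew shifted diagram `λ/μ`. -/
def skewDiagram (lam mu : StrictPartition) : Set (ℕ × ℕ) :=
  lam.shiftedDiagram \ mu.shiftedDiagram

/-- The standard shifted Young tableaux of shape `λ/μ`: the bijections from the boxes of `λ/μ`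
to `{1, …, |λ| - |μ|}` that increase along each row and down each column. -/
def standardShiftedTableaux (lam mu : StrictPartition) :
    Set (lam.skewDiagram mu ≃ Finset.Icc 1 (lam.size - mu.size)) :=
  {T | (∀ b c : lam.skewDiagram mu, c.1 = (b.1.1 + 1, b.1.2) → T b < T c) ∧
       (∀ b c : lam.skewDiagram mu, c.1 = (b.1.1, b.1.2 + 1) → T b < T c)}

/-- The dimension `g_{λ/μ}`: the number of standard shifted Young tableaux of shape `λ/μ`. -/
noncomputable def skewDim (lam mu : StrictPartition) : ℕ :=
  (lam.standardShiftedTableaux mu).ncard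

end StrictPartition

/-- The Pfaffian of a (skew-symmetric) `2n × 2n` matrix: the sum of
`sgn ω * ∏ i, a (ω (2i-1)) (ω (2i))` over the permutations `ω` with `ω (2i-1) < ω (2i)`
for all `i` and `ω 1 < ω 3 < … < ω (2n-1)` (here with indices counted from `0`). -/
def pfaffian {R : Type*} [CommRing R] {n : ℕ} (A : Matrix (Fin (2 * n)) (Fin (2 * n)) R) : R :=
  ∑ w : Equiv.Perm (Fin (2 * n)) with
      (∀ i : Fin n, w ⟨2 * i, by omega⟩ < w ⟨2 * i + 1, by omega⟩) ∧
      (∀ i j : Fin n, i < j → w ⟨2 * i, by omega⟩ < w ⟨2 * j, by omega⟩),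
    ((Equiv.Perm.sign w : ℤ) : R) *
      ∏ i : Fin n, A (w ⟨2 * i, by omega⟩) (w ⟨2 * i + 1, by omega⟩)

namespace StrictPartition

/-- The matrix `X(x₁, …, x_k)` with entries `(x_i - x_j) / (x_i + x_j) * 1 / (x_i! x_j!)`.
At most one `x_i` is zero in our use, and the diagonal entries are `0`, also for `x_i = 0`
(where the division is `0 / 0 = 0`). -/
def matX (xs : List ℕ) : Matrix (Fin xs.length) (Fin xs.length) ℚ :=
  Matrix.of fun i j =>
    (((xs.get i : ℕ) : ℚ) - ((xs.get j : ℕ) : ℚ)) / (((xs.get i : ℕ) : ℚ) + ((xs.get j : ℕ) : ℚ)) *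
      (1 / (((xs.get i)! : ℚ) * ((xs.get j)! : ℚ)))

/-- `1 / (a - b)!`, understood as `0` if `a < b`. -/
def invFactorialSub (a b : ℕ) : ℚ := if b ≤ a then 1 / ((a - b)! : ℚ) else 0

/-- The matrix `Y(x₁, …, x_k; μ)` with entries `1 / (x_i - μ_{ℓ(μ)+1-j})!`, so that the parts
of `μ` label the columns in increasing order. -/
def matY (xs : List ℕ) (mu : StrictPartition) : Matrix (Fin xs.length) (Fin mu.length) ℚ :=
  Matrix.of fun i j => invFactorialSub (xs.get i) (mu.part j.rev)

/-- The parts of `λ`, followed by one zero if `ℓ(λ) + ℓ(μ)` is odd. -/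
def paddedParts (lam mu : StrictPartition) : List ℕ :=
  if Even (lam.length + mu.length) then lam.parts else lam.parts ++ [0]

theorem length_paddedParts_add (lam mu : StrictPartition) :
    (lam.paddedParts mu).length + mu.length = 2 * ((lam.length + mu.length + 1) / 2) := by
  unfold paddedParts
  split_ifs with h
  · rw [Nat.even_iff] at h
    simp only [length] at *
    omega
  · rw [Nat.even_iff] at h
    simp only [length, List.length_append, List.length_singleton] at *
    omega

/-- The skew-symmetric matrix `A_{λ/μ}`, with blocks `X`, `Y`, `-Yᵀ` and `0`; its order is
`ℓ(λ) + ℓ(μ)` or `ℓ(λ) + ℓ(μ) + 1`, whichever is even. -/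
def matA (lam mu : StrictPartition) :
    Matrix (Fin (2 * ((lam.length + mu.length + 1) / 2)))
      (Fin (2 * ((lam.length + mu.length + 1) / 2))) ℚ :=
  Matrix.reindex
    (finSumFinEquiv.trans (finCongr (length_paddedParts_add lam mu)))
    (finSumFinEquiv.trans (finCongr (length_paddedParts_add lam mu)))
    (Matrix.fromBlocks (matX (lam.paddedParts mu)) (matY (lam.paddedParts mu) mu)
      (-(matY (lam.paddedParts mu) mu).transpose) 0)

end StrictPartition

/-! ### Signed sums over perfect matchings -/

section PairedPermutations

open Equiv Equiv.Perm

/-! Both sides satisfy the same recursion in `|λ| - |μ|`. The largest entry of a standard tableau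
sits in an outer corner, so `g_{λ/μ}` is the sum of the numbers for the shapes with one removable
box deleted (`ncard_standardFillings_succ`).

For the Pfaffian, lowering a part of `λ` by one acts like a derivation. The entries satisfy
`K(x-1,y) + K(x,y-1) = (x+y) K(x,y)` and `K(x-1,m) = (x-m) K(x,m)` (`kernel_lowerLabel`). Each
matching term is a product over pairs, so summing over all parts of `λ` multiplies the Pfaffian by
the total weight `|λ| - |μ|` (`sum_pairSum_update`, `sum_labelPf_update`). The summands that do not
come from a removable box vanish: either two parts become equal, or too many parts of `μ` exceed the
remaining parts of `λ` (`mul_skewPf`). A part that drops to zero is absorbed by the parity padding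
(`skewPf_of_part_eq_zero`), and for `λ = μ` the Pfaffian is `1` (`listPf_nested`).

The lowering identity fails for a zero part of `λ`, so the padding zero is counted with `μ` during
the induction; this leaves the Pfaffian unchanged (`labelPf_succ`). Pfaffian identities are proved
for the sum over all permutations, which is `2 ^ n * n !` times the Pfaffian and needs no ordering
of the matchings. -/

/-- The permutation of `Fin n × Bool` that permutes the pairs by `π` and swaps the two members
of the pair `i` if `b i` holds. -/
def blockPerm {n : ℕ} (π : Perm (Fin n)) (b : Fin n → Bool) : Perm (Fin n × Bool) :=
  (prodCongrLeft fun _ : Bool => π) * (prodCongrRight fun i => if b i then boolNot else 1)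

theorem blockPerm_apply {n : ℕ} (π : Perm (Fin n)) (b : Fin n → Bool) (i : Fin n) (c : Bool) :
    blockPerm π b (i, c) = (π i, xor (b i) c) := by
  cases h : b i <;> simp [blockPerm, h, prodCongrLeft, prodCongrRight]

theorem sign_blockPerm {n : ℕ} (π : Perm (Fin n)) (b : Fin n → Bool) :
    sign (blockPerm π b) = ∏ i, if b i then -1 else 1 := by
  have h : sign boolNot = -1 := by decide
  rw [blockPerm, Perm.sign_mul, sign_prodCongrLeft, sign_prodCongrRight]
  simp only [Finset.prod_const, Finset.card_univ, Fintype.card_bool]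
  rw [Int.units_sq, one_mul]
  refine Finset.prod_congr rfl fun i _ => ?_
  split_ifs <;> simp [h]

variable {R : Type*} [CommRing R]

/-- The signed term of a permutation in the symmetrized Pfaffian. -/
def pairTerm {n : ℕ} (A : Matrix (Fin n × Bool) (Fin n × Bool) R) (σ : Perm (Fin n × Bool)) : R :=
  ((sign σ : ℤ) : R) * ∏ i, A (σ (i, false)) (σ (i, true))

/-- The symmetrized Pfaffian: the sum over all permutations, which counts every perfect matching
`2 ^ n * n !` times. -/
def pairSum {n : ℕ} (A : Matrix (Fin n × Bool) (Fin n × Bool) R) : R :=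
  ∑ σ, pairTerm A σ

/-- A swap within a pair changes both the sign and one matrix entry by `-1`. Permuting the pairs
moves both members alike, hence is an even permutation, and only reorders the product. -/
theorem pairTerm_mul_blockPerm {n : ℕ} {A : Matrix (Fin n × Bool) (Fin n × Bool) R}
    (hA : ∀ p q, A p q = -A q p) (σ : Perm (Fin n × Bool)) (π : Perm (Fin n)) (b : Fin n → Bool) :
    pairTerm A (σ * blockPerm π b) = pairTerm A σ := by
  have h1 : ∏ i, A ((σ * blockPerm π b) (i, false)) ((σ * blockPerm π b) (i, true)) =
      (∏ i, if b i then (-1 : R) else 1) * ∏ i, A (σ (i, false)) (σ (i, true)) := by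
    rw [← Equiv.prod_comp π fun i => A (σ (i, false)) (σ (i, true)), ← Finset.prod_mul_distrib]
    refine Finset.prod_congr rfl fun i _ => ?_
    simp only [Perm.mul_apply, blockPerm_apply]
    cases b i
    · simp
    · simpa using hA _ _
  have h2 : ((sign (blockPerm π b) : ℤ) : R) = ∏ i, if b i then (-1 : R) else 1 := by
    rw [sign_blockPerm]
    push_cast
    refine Finset.prod_congr rfl fun i _ => ?_
    split_ifs <;> simp
  have h3 : (∏ i, if b i then (-1 : R) else 1) * (∏ i, if b i then (-1 : R) else 1) = 1 := by
    rw [← Finset.prod_mul_distrib]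
    refine Finset.prod_eq_one fun i _ => ?_
    split_ifs <;> simp
  rw [pairTerm, pairTerm, h1, Perm.sign_mul]
  push_cast
  rw [h2]
  linear_combination (((sign σ : ℤ) : R) * ∏ i, A (σ (i, false)) (σ (i, true))) * h3

theorem pairSum_submatrix {n : ℕ} (A : Matrix (Fin n × Bool) (Fin n × Bool) R)
    (τ : Perm (Fin n × Bool)) :
    pairSum (A.submatrix τ τ) = ((sign τ : ℤ) : R) * pairSum A := by
  rw [pairSum, pairSum, ← Equiv.sum_comp (Equiv.mulLeft τ) (pairTerm A), Finset.mul_sum]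
  refine Finset.sum_congr rfl fun σ _ => ?_
  have h : ((sign τ : ℤ) : R) * ((sign τ : ℤ) : R) = 1 := by
    rcases Int.units_eq_one_or (sign τ) with h | h <;> simp [h]
  simp only [pairTerm, Equiv.coe_mulLeft, Perm.sign_mul, Perm.mul_apply, Matrix.submatrix_apply]
  push_cast
  linear_combination (-((sign σ : ℤ) : R) * ∏ i, A (τ (σ (i, false))) (τ (σ (i, true)))) * h

/-- The symmetrized Pfaffian vanishes if a set `P` of indices has to be matched into a
smaller set `Q`. -/
theorem pairSum_eq_zero_of_card_lt {n : ℕ} {A : Matrix (Fin n × Bool) (Fin n × Bool) R}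
    (hA : ∀ p q, A p q = -A q p) (P Q : Finset (Fin n × Bool)) (hcard : Q.card < P.card)
    (h : ∀ p ∈ P, ∀ q ∉ Q, A p q = 0) : pairSum A = 0 := by
  refine Finset.sum_eq_zero fun σ _ => ?_
  by_contra hσ
  have hne : ∀ i c, A (σ (i, c)) (σ (i, !c)) ≠ 0 := by
    intro i c h0
    have h1 : A (σ (i, false)) (σ (i, true)) = 0 := by
      cases c
      · exact h0
      · rw [hA]; simpa using h0
    exact hσ (by rw [pairTerm, Finset.prod_eq_zero (Finset.mem_univ i) h1, mul_zero])
  -- `f` sends each index to its partner in the matching given by `σ`; a nonzero term would make it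
  -- inject `P` into `Q`.
  let f : Perm (Fin n × Bool) := σ * blockPerm 1 (fun _ => true) * σ⁻¹
  have hf : ∀ p, A p (f p) ≠ 0 := by
    intro p
    obtain ⟨⟨i, c⟩, rfl⟩ := σ.surjective p
    simpa [f, blockPerm_apply] using hne i c
  have := Finset.card_le_card_of_injOn f (s := P) (t := Q)
    (fun p hp => by by_contra hq; exact hf p (h p hp _ hq)) f.injective.injOn
  omega

/-- The two consecutive indices `2 * i` and `2 * i + 1` as a pair. -/
def pairIndex (n : ℕ) : Fin n × Bool ≃ Fin (2 * n) where
  toFun p := ⟨2 * p.1 + p.2.toNat, by have := p.1.2; have := p.2.toNat_lt; omega⟩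
  invFun j := (⟨j / 2, by omega⟩, decide (j.1 % 2 = 1))
  left_inv := by
    rintro ⟨i, c⟩
    cases c <;> simp [Fin.ext_iff]; omega
  right_inv := by
    intro j
    rcases Nat.mod_two_eq_zero_or_one j.1 with h | h <;> simp [h, Fin.ext_iff] <;> omega

/-- Ordering each pair determines the swaps, and sorting the pairs by their smaller members
determines `π`: each matching has one normalized representative. -/
theorem exists_unique_blockPerm {n : ℕ} (σ : Perm (Fin n × Bool)) :
    ∃! h : Perm (Fin n) × (Fin n → Bool),
      (∀ i, pairIndex n ((σ * blockPerm h.1 h.2) (i, false)) <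
        pairIndex n ((σ * blockPerm h.1 h.2) (i, true))) ∧
      ∀ i j, i < j → pairIndex n ((σ * blockPerm h.1 h.2) (i, false)) <
        pairIndex n ((σ * blockPerm h.1 h.2) (j, false)) := by
  let v : Fin n × Bool → Fin (2 * n) := fun p => pairIndex n (σ p)
  have hv : Function.Injective v := (pairIndex n).injective.comp σ.injective
  -- `b` marks the pairs that `σ` lists in decreasing order, so that `m i` below is the smaller
  -- member of the pair `i`.
  let b : Fin n → Bool := fun i => decide (v (i, true) < v (i, false))
  have hb : ∀ i c, (v (i, c) < v (i, !c)) ↔ c = b i := by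
    intro i c
    have : v (i, true) ≠ v (i, false) := fun h => by simpa using hv h
    rcases lt_or_gt_of_ne this with h | h <;> cases c <;> simp [b, h, h.not_gt]
  let m : Fin n → Fin (2 * n) := fun i => v (i, b i)
  have hm : Function.Injective m := fun i j h => (Prod.ext_iff.1 (hv h)).1
  have key : ∀ (π : Perm (Fin n)) (c : Fin n → Bool),
      ((∀ i, pairIndex n ((σ * blockPerm π c) (i, false)) <
        pairIndex n ((σ * blockPerm π c) (i, true))) ∧
      ∀ i j, i < j → pairIndex n ((σ * blockPerm π c) (i, false)) <
        pairIndex n ((σ * blockPerm π c) (j, false))) ↔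
      (c = b ∘ π ∧ Monotone (m ∘ π)) := by
    intro π c
    have e1 : (∀ i, pairIndex n ((σ * blockPerm π c) (i, false)) <
        pairIndex n ((σ * blockPerm π c) (i, true))) ↔ c = b ∘ π := by
      rw [funext_iff]
      refine forall_congr' fun i => ?_
      simp only [Perm.mul_apply, blockPerm_apply, Bool.xor_false, Bool.xor_true]
      exact hb _ _
    rw [e1]
    refine and_congr_right fun hc => ?_
    subst hc
    simp only [Perm.mul_apply, blockPerm_apply, Bool.xor_false]
    have : StrictMono (m ∘ π) ↔ Monotone (m ∘ π) :=
      ⟨StrictMono.monotone, fun h => h.strictMono_of_injective (hm.comp π.injective)⟩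
    rw [← this]
    exact Iff.rfl
  refine ⟨(Tuple.sort m, b ∘ Tuple.sort m), (key _ _).2 ⟨rfl, Tuple.monotone_sort m⟩, ?_⟩
  rintro ⟨π, c⟩ h
  obtain ⟨hc, hπ⟩ := (key _ _).1 h
  have : m ∘ π = m ∘ Tuple.sort m := Tuple.unique_monotone hπ (Tuple.monotone_sort m)
  have hπ' : π = Tuple.sort m := Equiv.ext fun i => hm (congrFun this i)
  refine Prod.ext hπ' ?_
  rw [← hπ']
  exact hc

/-- Double counting: each term is charged to the normalized permutation in its coset, and the order
of summation is exchanged. No division is involved, so any commutative ring will do. -/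
theorem pairSum_pairIndex {n : ℕ} {A : Matrix (Fin (2 * n)) (Fin (2 * n)) R}
    (hA : ∀ p q, A p q = -A q p) :
    pairSum (A.submatrix (pairIndex n) (pairIndex n)) = (2 ^ n * n ! : ℕ) * pfaffian A := by
  classical
  let B := A.submatrix (pairIndex n) (pairIndex n)
  have hB : ∀ p q, B p q = -B q p := fun p q => hA _ _
  let good : Perm (Fin n × Bool) → Prop := fun σ =>
      (∀ i, pairIndex n (σ (i, false)) < pairIndex n (σ (i, true))) ∧
      ∀ i j, i < j → pairIndex n (σ (i, false)) < pairIndex n (σ (j, false))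
  have h1 : ∀ σ, pairTerm B σ = ∑ h : Perm (Fin n) × (Fin n → Bool),
      if good (σ * blockPerm h.1 h.2) then pairTerm B (σ * blockPerm h.1 h.2) else 0 := by
    intro σ
    obtain ⟨h, hh, hu⟩ := exists_unique_blockPerm σ
    rw [Finset.sum_eq_single h]
    · rw [if_pos hh, pairTerm_mul_blockPerm hB]
    · intro h' _ hne
      exact if_neg fun hg => hne (hu h' hg)
    · simp
  have h2 : pfaffian A = ∑ σ, if good σ then pairTerm B σ else 0 := by
    rw [pfaffian, Finset.sum_filter, ← Equiv.sum_comp (Equiv.permCongr (pairIndex n))]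
    have e0 : ∀ i : Fin n, (pairIndex n).symm ⟨2 * i, by omega⟩ = (i, false) := by
      intro i; rw [Equiv.symm_apply_eq]; simp [pairIndex]
    have e1 : ∀ i : Fin n, (pairIndex n).symm ⟨2 * i + 1, by omega⟩ = (i, true) := by
      intro i; rw [Equiv.symm_apply_eq]; simp [pairIndex]
    refine Finset.sum_congr rfl fun σ _ => ?_
    simp only [Equiv.permCongr_apply, e0, e1, good, pairTerm, B, sign_permCongr,
      Matrix.submatrix_apply]
  change pairSum B = _
  rw [pairSum, Finset.sum_congr rfl fun σ _ => h1 σ, Finset.sum_comm]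
  have h3 : ∀ h : Perm (Fin n) × (Fin n → Bool),
      (∑ σ, if good (σ * blockPerm h.1 h.2) then pairTerm B (σ * blockPerm h.1 h.2) else 0) =
        pfaffian A := by
    intro h
    rw [h2]
    exact Equiv.sum_comp (Equiv.mulRight (blockPerm h.1 h.2))
      fun σ => if good σ then pairTerm B σ else 0
  rw [Finset.sum_congr rfl fun h _ => h3 h, Finset.sum_const, nsmul_eq_mul]
  congr 2
  simp [Fintype.card_perm, mul_comm]

/-- The inclusion of pairs that omits the pair `0`. -/
def succPair {n : ℕ} (p : Fin n × Bool) : Fin (n + 1) × Bool := (p.1.succ, p.2)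

/-- `succPair` as an equivalence onto the indices outside the pair `0`. -/
def succPairEquiv (n : ℕ) : Fin n × Bool ≃ {p : Fin (n + 1) × Bool // p.1 ≠ 0} where
  toFun p := ⟨succPair p, Fin.succ_ne_zero _⟩
  invFun p := (p.1.1.pred p.2, p.1.2)
  left_inv p := by simp [succPair]
  right_inv p := by simp [succPair]

theorem sum_pairTerm_of_fixed {n : ℕ} (A : Matrix (Fin (n + 1) × Bool) (Fin (n + 1) × Bool) R) :
    (∑ σ with σ (0, false) = (0, false) ∧ σ (0, true) = (0, true), pairTerm A σ) =
      A (0, false) (0, true) * pairSum (A.submatrix succPair succPair) := by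
  rw [pairSum, Finset.mul_sum]
  symm
  have hs : ∀ (ρ : Perm (Fin n × Bool)) p,
      ρ.extendDomain (succPairEquiv n) (succPair p) = succPair (ρ p) := fun ρ p =>
    ρ.extendDomain_apply_image (succPairEquiv n) p
  have hz : ∀ (ρ : Perm (Fin n × Bool)) c,
      ρ.extendDomain (succPairEquiv n) (0, c) = (0, c) := fun ρ c =>
    ρ.extendDomain_apply_not_subtype (succPairEquiv n) (by simp)
  refine Finset.sum_bij (fun ρ _ => ρ.extendDomain (succPairEquiv n)) ?_ ?_ ?_ ?_
  · intro ρ _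
    simp [hz]
  · intro ρ _ ρ' _ h
    exact extendDomainHom_injective (succPairEquiv n) h
  · intro σ hσ
    obtain ⟨h0, h1⟩ := (Finset.mem_filter.1 hσ).2
    have hc : ∀ c, σ (0, c) = (0, c) := fun c => by cases c <;> assumption
    have hne : ∀ p, (σ p).1 ≠ 0 ↔ p.1 ≠ 0 := by
      intro p
      refine not_congr ⟨fun h => ?_, fun h => ?_⟩
      · have : σ p = σ (0, (σ p).2) := by rw [hc]; exact Prod.ext h rfl
        rw [σ.injective this]
      · obtain ⟨i, c⟩ := p
        subst h
        rw [hc]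
    refine ⟨(succPairEquiv n).symm.permCongr (σ.subtypePerm hne), Finset.mem_univ _, ?_⟩
    ext1 p
    by_cases hp : p.1 = 0
    · obtain ⟨i, c⟩ := p
      subst hp
      rw [hz, hc]
    · obtain ⟨q, hq⟩ := (succPairEquiv n).surjective ⟨p, hp⟩
      have hq' : succPair q = p := congrArg Subtype.val hq
      rw [← hq', hs]
      change ((succPairEquiv n) ((succPairEquiv n).symm.permCongr (σ.subtypePerm hne) q)).1 = _
      simp [Equiv.permCongr_apply, hq, hq']
  · intro ρ _
    rw [pairTerm, pairTerm, sign_extendDomain, Fin.prod_univ_succ, hz, hz]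
    have : ∀ (i : Fin n) c, ρ.extendDomain (succPairEquiv n) (i.succ, c) = succPair (ρ (i, c)) :=
      fun i c => hs ρ (i, c)
    simp only [this, Matrix.submatrix_apply]
    ring

/-- If the pair `(0, false)`, `(0, true)` is such that only the matchings containing it
contribute, then the symmetrized Pfaffian factors. -/
theorem pairSum_eq_mul {n : ℕ} {A : Matrix (Fin (n + 1) × Bool) (Fin (n + 1) × Bool) R}
    (hA : ∀ p q, A p q = -A q p)
    (h : (∀ q : Fin (n + 1) × Bool, q.1 ≠ 0 → A (0, false) q = A (0, true) q) ∨
      ∀ q : Fin (n + 1) × Bool, q.1 ≠ 0 → A (0, true) q = 0) :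
    pairSum A = 2 * (n + 1) * (A (0, false) (0, true) *
      pairSum (A.submatrix succPair succPair)) := by
  let u : Fin (n + 1) × Bool := (0, false)
  let v : Fin (n + 1) × Bool := (0, true)
  have huv : u ≠ v := by simp [u, v]
  have hother : ∀ p, p ≠ u → p ≠ v → p.1 ≠ 0 := by
    rintro ⟨i, c⟩ h1 h2 rfl
    cases c
    · exact h1 rfl
    · exact h2 rfl
  have hA' : ∀ i c (σ : Perm (Fin (n + 1) × Bool)), A (σ (i, c)) (σ (i, !c)) = 0 →
      pairTerm A σ = 0 := by
    intro i c σ h0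
    have h1 : A (σ (i, false)) (σ (i, true)) = 0 := by
      cases c
      · exact h0
      · rw [hA]; simpa using h0
    rw [pairTerm, Finset.prod_eq_zero (Finset.mem_univ i) h1, mul_zero]
  let paired : Perm (Fin (n + 1) × Bool) → Prop := fun σ => (σ⁻¹ u).1 = (σ⁻¹ v).1
  have hunp : ∑ σ with ¬ paired σ, pairTerm A σ = 0 := by
    rcases h with h | h
    -- When `u` and `v` have different partners, exchanging them preserves every matrix entry,
    -- because their rows agree outside the pair `0`, and reverses the sign.
    · refine Finset.sum_involution (fun σ _ => swap u v * σ) ?_ ?_ ?_ ?_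
      · intro σ hσ
        have hσ' : ¬ paired σ := (Finset.mem_filter.1 hσ).2
        have : ∀ i, A (swap u v (σ (i, false))) (swap u v (σ (i, true))) =
            A (σ (i, false)) (σ (i, true)) := by
          intro i
          have hi1 : ¬ (σ (i, false) = u ∧ σ (i, true) = v) := fun ⟨h1, h2⟩ =>
            hσ' (by simp [paired, ← h1, ← h2])
          have hi2 : ¬ (σ (i, false) = v ∧ σ (i, true) = u) := fun ⟨h1, h2⟩ =>
            hσ' (by simp [paired, ← h1, ← h2])
          have hi3 : σ (i, false) ≠ σ (i, true) := by simp
          generalize σ (i, false) = p at *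
          generalize σ (i, true) = q at *
          by_cases p1 : p = u
          · subst p1
            have hq : q ≠ v := fun h => hi1 ⟨rfl, h⟩
            rw [swap_apply_left, swap_apply_of_ne_of_ne hi3.symm hq]
            exact (h q (hother q hi3.symm hq)).symm
          by_cases p2 : p = v
          · subst p2
            have hq : q ≠ u := fun h => hi2 ⟨rfl, h⟩
            rw [swap_apply_right, swap_apply_of_ne_of_ne hq hi3.symm]
            exact h q (hother q hq hi3.symm)
          rw [swap_apply_of_ne_of_ne p1 p2, hA, hA p]
          by_cases q1 : q = u
          · subst q1
            rw [swap_apply_left]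
            exact congrArg _ (h p (hother p p1 p2)).symm
          by_cases q2 : q = v
          · subst q2
            rw [swap_apply_right]
            exact congrArg _ (h p (hother p p1 p2))
          rw [swap_apply_of_ne_of_ne q1 q2]
        simp only [pairTerm, Perm.mul_apply, this, Perm.sign_mul, sign_swap huv]
        push_cast
        ring
      · intro σ _ _ hs
        have := congrArg (fun τ : Perm _ => τ (σ⁻¹ u)) hs
        simp at this
        exact huv this.symm
      · intro σ hσ
        have hσ' : ¬ paired σ := (Finset.mem_filter.1 hσ).2
        simp only [Finset.mem_filter, Finset.mem_univ, true_and, paired, mul_inv_rev, swap_inv,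
          Perm.mul_apply, swap_apply_left, swap_apply_right]
        exact fun h => hσ' h.symm
      · intro σ _
        rw [swap_mul_self_mul]
    · refine Finset.sum_eq_zero fun σ hσ => ?_
      have hσ' : ¬ paired σ := (Finset.mem_filter.1 hσ).2
      obtain ⟨⟨i, c⟩, hi⟩ := σ.surjective v
      refine hA' i c σ ?_
      rw [hi]
      refine h _ (hother _ (fun h => hσ' ?_) (fun h => ?_))
      · simp [paired, ← h, ← hi]
      · simpa using σ.injective (h.trans hi.symm)
  -- The remaining terms are split by the position `p` of `u`. There are `2 * (n + 1)` positions,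
  -- and block permutations carry each of them to `(0, false)`.
  have hp : ∀ σ, (if paired σ then pairTerm A σ else 0) = ∑ p : Fin (n + 1) × Bool,
      if σ (p.1, p.2) = u ∧ σ (p.1, !p.2) = v then pairTerm A σ else 0 := by
    intro σ
    rw [Finset.sum_eq_single (σ⁻¹ u)]
    · refine if_congr ?_ rfl rfl
      simp only [Prod.mk.eta, ← Perm.eq_inv_iff_eq, true_and, paired]
      refine ⟨fun h => Prod.ext h ?_, fun h => by rw [← h]⟩
      have : (σ⁻¹ u).2 ≠ (σ⁻¹ v).2 := fun h' => huv (σ⁻¹.injective (Prod.ext h h'))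
      revert this
      simp only
      cases (σ⁻¹ u).2 <;> cases (σ⁻¹ v).2 <;> simp
    · intro p _ hne
      refine if_neg fun h => hne ?_
      rw [Perm.eq_inv_iff_eq]
      exact h.1
    · simp
  have hfix : ∀ p : Fin (n + 1) × Bool,
      (∑ σ, if σ (p.1, p.2) = u ∧ σ (p.1, !p.2) = v then pairTerm A σ else 0) =
        A (0, false) (0, true) * pairSum (A.submatrix succPair succPair) := by
    rintro ⟨i, c⟩
    rw [← sum_pairTerm_of_fixed, Finset.sum_filter]
    refine Eq.trans (Finset.sum_congr rfl fun σ _ => ?_)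
      (Equiv.sum_comp (Equiv.mulRight (blockPerm (swap 0 i) fun _ => c)) _)
    simp only [Equiv.coe_mulRight, pairTerm_mul_blockPerm hA, Perm.mul_apply, blockPerm_apply,
      swap_apply_left, Bool.xor_false, Bool.xor_true, u, v]
  rw [pairSum, ← Finset.sum_filter_add_sum_filter_not _ paired, hunp, add_zero,
    Finset.sum_filter, Finset.sum_congr rfl fun σ _ => hp σ, Finset.sum_comm,
    Finset.sum_congr rfl fun p _ => hfix p, Finset.sum_const, nsmul_eq_mul]
  congr 1
  simp [mul_comm]

end PairedPermutations

/-! ### Pfaffians of a kernel on a list of labels -/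

section KernelPfaffians

open Equiv Equiv.Perm

variable {R : Type*} [CommRing R] {α : Type*}

/-- This is a Leibniz rule. In every matching term an index occurs in exactly one factor, so the
two-variable identity `h` is applied to one pair at a time and the weights add up. -/
theorem sum_pairSum_update {n : ℕ} (K : α → α → R) (c wt : α → R) (dec : α → α)
    (v : Fin n × Bool → α)
    (h : ∀ p q, p ≠ q → c (v p) * K (dec (v p)) (v q) + c (v q) * K (v p) (dec (v q)) =
      (wt (v p) + wt (v q)) * K (v p) (v q)) :
    ∑ p, c (v p) * pairSum (.of fun i j => K (Function.update v p (dec (v p)) i)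
        (Function.update v p (dec (v p)) j)) =
      (∑ p, wt (v p)) * pairSum (.of fun i j => K (v i) (v j)) := by
  simp only [pairSum, Finset.mul_sum]
  rw [Finset.sum_comm]
  refine Finset.sum_congr rfl fun σ _ => ?_
  rw [← Equiv.sum_comp σ fun p => wt (v p), ← Equiv.sum_comp σ, Fintype.sum_prod_type, Fintype.sum_prod_type,
    Finset.sum_mul]
  refine Finset.sum_congr rfl fun j _ => ?_
  simp only [Fintype.sum_bool]
  have hT : ∀ w : Fin n × Bool → α, (∀ i, i ≠ j → ∀ b, w (σ (i, b)) = v (σ (i, b))) →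
      pairTerm (.of fun p q => K (w p) (w q)) σ = ((sign σ : ℤ) : R) *
        (K (w (σ (j, false))) (w (σ (j, true))) *
          ∏ i ∈ Finset.univ.erase j, K (v (σ (i, false))) (v (σ (i, true)))) := by
    intro w hw
    rw [pairTerm, ← Finset.mul_prod_erase _ _ (Finset.mem_univ j)]
    congr 2
    refine Finset.prod_congr rfl fun i hi => ?_
    simp [hw i (Finset.ne_of_mem_erase hi)]
  rw [hT v fun _ _ _ => rfl, hT, hT]
  · have e1 : σ (j, true) ≠ σ (j, false) := by simp
    simp only [Function.update_self, Function.update_of_ne e1, Function.update_of_ne e1.symm]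
    linear_combination (((sign σ : ℤ) : R) *
      ∏ i ∈ Finset.univ.erase j, K (v (σ (i, false))) (v (σ (i, true)))) * h _ _ e1.symm
  all_goals
    intro i hi b
    exact Function.update_of_ne (fun h => hi (Prod.ext_iff.1 (σ.injective h)).1) _ _

/-- The Pfaffian of the matrix `K a b`, with `a` and `b` running over the first `2 * n` entries
of a list. -/
def listPf (K : α → α → ℚ) (d : α) (n : ℕ) (L : List α) : ℚ :=
  pfaffian (n := n) (.of fun i j => K (L.getD i d) (L.getD j d))

variable {K : α → α → ℚ} {d : α} {n : ℕ}

theorem pairSum_getD (hK : ∀ a b, K a b = -K b a) (L : List α) :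
    pairSum (.of fun p q : Fin n × Bool =>
        K (L.getD (pairIndex n p) d) (L.getD (pairIndex n q) d)) =
      (2 ^ n * n ! : ℕ) * listPf K d n L :=
  pairSum_pairIndex (A := .of fun i j : Fin (2 * n) => K (L.getD i d) (L.getD j d))
    fun _ _ => hK _ _

theorem listPf_eq (hK : ∀ a b, K a b = -K b a) (L : List α) :
    listPf K d n L = pairSum (.of fun p q : Fin n × Bool =>
        K (L.getD (pairIndex n p) d) (L.getD (pairIndex n q) d)) / (2 ^ n * n ! : ℕ) := by
  rw [pairSum_getD hK, mul_div_cancel_left₀]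
  positivity

theorem listPf_congr {L L' : List α}
    (h : ∀ i j, i < 2 * n → j < 2 * n →
      K (L.getD i d) (L.getD j d) = K (L'.getD i d) (L'.getD j d)) :
    listPf K d n L = listPf K d n L' := by
  unfold listPf
  congr 1
  ext i j
  exact h i j i.2 j.2

theorem listPf_swap (hK : ∀ a b, K a b = -K b a) {L L' : List α} {i j : ℕ} (hij : i ≠ j)
    (hi : i < 2 * n) (hj : j < 2 * n) (h : ∀ a, L'.getD a d = L.getD (swap i j a) d) :
    listPf K d n L' = -listPf K d n L := by
  let τ : Perm (Fin n × Bool) := swap ((pairIndex n).symm ⟨i, hi⟩) ((pairIndex n).symm ⟨j, hj⟩)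
  have hτ : ∀ p, (pairIndex n (τ p) : ℕ) = swap i j (pairIndex n p : ℕ) := by
    intro p
    have h1 : pairIndex n (τ p) = swap ⟨i, hi⟩ ⟨j, hj⟩ (pairIndex n p) := by
      rw [(pairIndex n).injective.map_swap, Equiv.apply_symm_apply, Equiv.apply_symm_apply]
    rw [h1]
    simp only [swap_apply_def, Fin.ext_iff]
    split_ifs <;> rfl
  have hs := pairSum_submatrix (.of fun p q : Fin n × Bool =>
        K (L.getD (pairIndex n p) d) (L.getD (pairIndex n q) d)) τ
  have hsign : sign τ = -1 := sign_swap (by simpa using hij)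
  rw [listPf_eq hK, listPf_eq hK, ← neg_div]
  congr 1
  rw [hsign] at hs
  simp only [Units.val_neg, Units.val_one, Int.cast_neg, Int.cast_one, neg_one_mul] at hs
  rw [← hs]
  congr 1
  ext p q
  simp only [Matrix.of_apply, Matrix.submatrix_apply, h, hτ]

theorem listPf_eq_zero_of_getD_eq (hK : ∀ a b, K a b = -K b a) {L : List α} {i j : ℕ}
    (hij : i ≠ j) (hi : i < 2 * n) (hj : j < 2 * n) (h : L.getD i d = L.getD j d) :
    listPf K d n L = 0 := by
  have := listPf_swap (d := d) (n := n) hK (L := L) (L' := L) hij hi hj fun a => by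
    rw [swap_apply_def]
    split_ifs with h1 h2
    · rw [h1, h]
    · rw [h2, h]
    · rfl
  linarith

theorem listPf_append_swap (hK : ∀ a b, K a b = -K b a) (A B : List α) (x y : α)
    (h : A.length + 2 ≤ 2 * n) :
    listPf K d n (A ++ x :: y :: B) = -listPf K d n (A ++ y :: x :: B) := by
  refine listPf_swap hK (i := A.length) (j := A.length + 1) (by omega) (by omega) (by omega) ?_
  intro a
  rw [swap_apply_def]
  split_ifs with h1 h2
  · simp [h1]
  · simp [h2]
  · rcases lt_or_ge a A.length with h3 | h3
    · rw [List.getD_append _ _ _ _ h3, List.getD_append _ _ _ _ h3]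
    · rw [List.getD_append_right _ _ _ _ h3, List.getD_append_right _ _ _ _ h3]
      obtain ⟨b, rfl⟩ : ∃ b, a = A.length + (b + 2) := ⟨a - A.length - 2, by omega⟩
      simp

theorem listPf_append_cons (hK : ∀ a b, K a b = -K b a) (A B C : List α) (x : α)
    (h : C.length + A.length + 1 ≤ 2 * n) :
    listPf K d n (C ++ (A ++ x :: B)) = (-1) ^ A.length * listPf K d n (C ++ x :: (A ++ B)) := by
  induction A generalizing C with
  | nil => simp
  | cons a A ih =>
    have h1 := ih (C ++ [a]) (by simp at h ⊢; omega)
    simp only [List.append_assoc, List.cons_append, List.nil_append] at h1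
    rw [List.cons_append, h1, listPf_append_swap hK _ _ _ _ (by simp at h; omega)]
    simp [pow_succ]

theorem listPf_cons_cons (hK : ∀ a b, K a b = -K b a) {l : List α} {x y : α}
    (hl : l.length = 2 * n)
    (h : (∀ z ∈ l, K x z = K y z) ∨ ∀ z ∈ l, K y z = 0) :
    listPf K d (n + 1) (x :: y :: l) = K x y * listPf K d n l := by
  have hs : ∀ p : Fin n × Bool, (x :: y :: l).getD (pairIndex (n + 1) (succPair p)) d =
      l.getD (pairIndex n p) d := by
    intro p
    have : (pairIndex (n + 1) (succPair p) : ℕ) = pairIndex n p + 2 := by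
      simp [pairIndex, succPair]; omega
    rw [this]
    simp
  have hmem : ∀ q : Fin (n + 1) × Bool, q.1 ≠ 0 →
      (x :: y :: l).getD (pairIndex (n + 1) q) d ∈ l := by
    intro q hq
    obtain ⟨p, hp⟩ := (succPairEquiv n).surjective ⟨q, hq⟩
    have hp' : succPair p = q := congrArg Subtype.val hp
    rw [← hp', hs]
    have := (pairIndex n p).2
    rw [List.getD_eq_getElem _ _ (by omega)]
    exact List.getElem_mem _
  have := pairSum_eq_mul (n := n) (A := .of fun p q : Fin (n + 1) × Bool =>
    K ((x :: y :: l).getD (pairIndex (n + 1) p) d) ((x :: y :: l).getD (pairIndex (n + 1) q) d))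
    (fun _ _ => hK _ _) (h.imp (fun h q hq => h _ (hmem q hq)) fun h q hq => h _ (hmem q hq))
  have hsub : (Matrix.of fun p q : Fin (n + 1) × Bool =>
      K ((x :: y :: l).getD (pairIndex (n + 1) p) d)
        ((x :: y :: l).getD (pairIndex (n + 1) q) d)).submatrix succPair succPair =
      .of fun p q : Fin n × Bool => K (l.getD (pairIndex n p) d) (l.getD (pairIndex n q) d) := by
    ext p q
    simp only [Matrix.submatrix_apply, Matrix.of_apply, hs]
  rw [hsub, pairSum_getD hK, pairSum_getD hK] at this
  have h0 : ((2 ^ (n + 1) * (n + 1)! : ℕ) : ℚ) ≠ 0 := by positivity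
  refine mul_left_cancel₀ h0 (this.trans ?_)
  rw [Nat.factorial_succ]
  push_cast
  change 2 * ((n : ℚ) + 1) * (K x y * _) = _
  ring

/-- Matchings that separate `x` and `y` cancel in couples. Moving both labels past `A` costs the
sign `(-1) ^ A.length` twice. -/
theorem listPf_append_pair (hK : ∀ a b, K a b = -K b a) {A B : List α} {x y : α}
    (hl : A.length + B.length = 2 * n) (h : ∀ z ∈ A ++ B, K x z = K y z) :
    listPf K d (n + 1) (A ++ x :: y :: B) = K x y * listPf K d n (A ++ B) := by
  have h1 := listPf_append_cons (d := d) (n := n + 1) hK A (y :: B) [] x (by simp; omega)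
  have h2 := listPf_append_cons (d := d) (n := n + 1) hK A B [x] y (by simp; omega)
  simp only [List.nil_append, List.cons_append] at h1 h2
  rw [h1, h2, ← mul_assoc, ← mul_pow, listPf_cons_cons hK (by simpa using hl) (Or.inl h)]
  simp

/-- The label `y` can only be matched with `x`, and it moves past an even number of labels, so no
sign appears. -/
theorem listPf_cons_append_singleton (hK : ∀ a b, K a b = -K b a) {l : List α} {x y : α}
    (hl : l.length = 2 * n) (h : ∀ z ∈ l, K y z = 0) :
    listPf K d (n + 1) (x :: (l ++ [y])) = K x y * listPf K d n l := by
  have h2 := listPf_append_cons (d := d) (n := n + 1) hK l [] [x] y (by simp; omega)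
  simp only [List.nil_append, List.cons_append, List.append_nil] at h2
  rw [h2, listPf_cons_cons hK hl (Or.inr h), hl]
  simp

theorem listPf_eq_zero_of_card_lt (hK : ∀ a b, K a b = -K b a) {L : List α}
    (P Q : Finset ℕ) (hP : ∀ p ∈ P, p < 2 * n) (hcard : Q.card < P.card)
    (h : ∀ p ∈ P, ∀ q, q < 2 * n → q ∉ Q → K (L.getD p d) (L.getD q d) = 0) :
    listPf K d n L = 0 := by
  classical
  let f : Fin n × Bool ↪ ℕ := ⟨fun p => pairIndex n p, fun p q h =>
    (pairIndex n).injective (Fin.ext h)⟩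
  have hf : ∀ p, f p = pairIndex n p := fun _ => rfl
  rw [listPf_eq hK, pairSum_eq_zero_of_card_lt (fun p q => by exact hK _ _)
    (Finset.univ.filter fun p => f p ∈ P) (Finset.univ.filter fun p => f p ∈ Q), zero_div]
  · have h1 : (Finset.univ.filter fun p => f p ∈ P).map f = P := by
      ext a
      simp only [Finset.mem_map, Finset.mem_filter, Finset.mem_univ, true_and]
      refine ⟨by rintro ⟨p, hp, rfl⟩; exact hp, fun ha => ?_⟩
      exact ⟨(pairIndex n).symm ⟨a, hP a ha⟩, by simpa [hf] using ha, by simp [hf]⟩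
    have h2 : (Finset.univ.filter fun p => f p ∈ Q).map f ⊆ Q := by
      intro a
      simp only [Finset.mem_map, Finset.mem_filter, Finset.mem_univ, true_and]
      rintro ⟨p, hp, rfl⟩; exact hp
    have h3 := Finset.card_le_card h2
    rw [Finset.card_map] at h3
    rw [← h1, Finset.card_map] at hcard
    omega
  · intro p hp q hq
    exact h _ (Finset.mem_filter.1 hp).2 _ (pairIndex n q).2 (by simpa [hf] using hq)

theorem sum_listPf_set (hK : ∀ a b, K a b = -K b a) (c wt : α → ℚ) (dec : α → α) {L : List α}
    (hL : L.length = 2 * n)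
    (h : ∀ a ∈ L, ∀ b ∈ L, c a * K (dec a) b + c b * K a (dec b) = (wt a + wt b) * K a b) :
    ∑ i ∈ Finset.range (2 * n),
        c (L.getD i d) * listPf K d n (L.set i (dec (L.getD i d))) =
      (L.map wt).sum * listPf K d n L := by
  have hmem : ∀ p : Fin n × Bool, L.getD (pairIndex n p) d ∈ L := by
    intro p
    have := (pairIndex n p).2
    rw [List.getD_eq_getElem _ _ (by omega)]
    exact List.getElem_mem _
  have key := sum_pairSum_update K c wt dec (fun p : Fin n × Bool => L.getD (pairIndex n p) d)
    fun p q _ => h _ (hmem p) _ (hmem q)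
  have hu : ∀ p : Fin n × Bool, Function.update (fun p => L.getD (pairIndex n p) d) p
      (dec (L.getD (pairIndex n p) d)) =
      fun q => (L.set (pairIndex n p) (dec (L.getD (pairIndex n p) d))).getD (pairIndex n q) d := by
    intro p
    ext1 q
    have hq := (pairIndex n q).2
    rw [List.getD_eq_getElem (L.set _ _) _ (by simp [hL]), List.getElem_set]
    by_cases hpq : q = p
    · subst hpq
      simp
    · rw [Function.update_of_ne hpq, if_neg, List.getD_eq_getElem _ _ (by omega)]
      exact fun h => hpq ((pairIndex n).injective (Fin.ext h.symm))
  have hwt : ∑ p : Fin n × Bool, wt (L.getD (pairIndex n p) d) = (L.map wt).sum := by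
    rw [Equiv.sum_comp (pairIndex n) fun i => wt (L.getD i d),
      Fin.sum_univ_eq_sum_range fun i => wt (L.getD i d), ← hL,
      ← Fin.sum_univ_eq_sum_range fun i => wt (L.getD i d), ← Fin.sum_univ_fun_getElem]
    simp
  simp only [hu, pairSum_getD hK] at key
  rw [hwt] at key
  rw [← Fin.sum_univ_eq_sum_range fun i => c (L.getD i d) *
    listPf K d n (L.set i (dec (L.getD i d))), ← Equiv.sum_comp (pairIndex n)]
  have h0 : ((2 ^ n * n ! : ℕ) : ℚ) ≠ 0 := by positivity
  refine mul_left_cancel₀ h0 ?_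
  rw [Finset.mul_sum, mul_left_comm, ← key]
  refine Finset.sum_congr rfl fun p _ => ?_
  ring

end KernelPfaffians

/-- Only the off-diagonal entries of the row of `x` matter, since `K x x` and `K y y` both vanish by
skew symmetry. -/
theorem listPf_congr_of_forall_mem {α : Type*} {K : α → α → ℚ} {d : α} {n : ℕ}
    (hK : ∀ a b, K a b = -K b a) {A B : List α} {x y : α}
    (hl : A.length + B.length + 1 = 2 * n) (h : ∀ z ∈ A ++ B, K x z = K y z) :
    listPf K d n (A ++ x :: B) = listPf K d n (A ++ y :: B) := by
  have hx := listPf_append_cons (d := d) (n := n) hK A B [] x (by simp; omega)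
  have hy := listPf_append_cons (d := d) (n := n) hK A B [] y (by simp; omega)
  rw [List.nil_append] at hx hy
  rw [hx, hy, List.nil_append, List.nil_append]
  congr 1
  refine listPf_congr fun i j hi hj => ?_
  have hmem : ∀ i, i + 1 < 2 * n → (A ++ B).getD i d ∈ A ++ B := by
    intro i hi
    rw [List.getD_eq_getElem _ _ (by simp; omega)]
    exact List.getElem_mem _
  have h0 : ∀ a, K a a = 0 := fun a => by linarith [hK a a]
  rcases i with _ | i <;> rcases j with _ | j
  · simp only [List.getD_cons_zero, h0]
  · simp only [List.getD_cons_zero, List.getD_cons_succ]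
    exact h _ (hmem _ hj)
  · simp only [List.getD_cons_zero, List.getD_cons_succ]
    rw [hK, hK _ y, h _ (hmem _ hi)]
  · rfl

/-! ### The kernel of `A_{λ/μ}` and its lowering identity -/

namespace StrictPartition

open Sum

/-- The entries of `A_{λ/μ}`, as a function of the row and column labels: `inl x` stands for a
part `x` of `λ` and `inr m` for a part `m` of `μ`. -/
def kernel : ℕ ⊕ ℕ → ℕ ⊕ ℕ → ℚ
  | inl x, inl y => ((x : ℚ) - y) / ((x : ℚ) + y) * (1 / ((x ! : ℚ) * (y ! : ℚ)))
  | inl x, inr m => invFactorialSub x m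
  | inr m, inl x => -invFactorialSub x m
  | inr _, inr _ => 0

theorem kernel_skew (a b : ℕ ⊕ ℕ) : kernel a b = -kernel b a := by
  rcases a with x | m <;> rcases b with y | m' <;> simp only [kernel, neg_neg, neg_zero]
  rw [← neg_sub, neg_div, add_comm (x : ℚ), mul_comm (x ! : ℚ), neg_mul]

theorem invFactorialSub_self (a : ℕ) : invFactorialSub a a = 1 := by simp [invFactorialSub]

theorem invFactorialSub_of_lt {a b : ℕ} (h : a < b) : invFactorialSub a b = 0 := by
  simp [invFactorialSub, h]

theorem invFactorialSub_succ (x m : ℕ) :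
    invFactorialSub x m = ((x : ℚ) + 1 - m) * invFactorialSub (x + 1) m := by
  rcases lt_trichotomy m (x + 1) with h | h | h
  · rw [invFactorialSub, invFactorialSub, if_pos (by omega), if_pos h.le]
    obtain ⟨e, rfl⟩ := Nat.exists_eq_add_of_le (Nat.lt_succ_iff.1 h)
    rw [Nat.add_sub_cancel_left, add_assoc, Nat.add_sub_cancel_left, Nat.factorial_succ]
    have : (e ! : ℚ) ≠ 0 := by positivity
    push_cast
    field_simp
    ring
  · subst h
    rw [invFactorialSub_of_lt (Nat.lt_succ_self x)]
    simp
  · rw [invFactorialSub_of_lt h, invFactorialSub_of_lt (by omega), mul_zero]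

/-- Against `x > 0` both entries are `-1 / x!`, and against a part `m > 0` of `μ` both are `0`.
Against a zero label they can differ, hence the positivity. -/
theorem kernel_inl_zero {z : ℕ ⊕ ℕ} (hz : (∃ x, 0 < x ∧ z = inl x) ∨ ∃ m, 0 < m ∧ z = inr m) :
    kernel (inl 0) z = kernel (inr 0) z := by
  rcases hz with ⟨x, hx, rfl⟩ | ⟨m, hm, rfl⟩
  · have : (x : ℚ) ≠ 0 := by positivity
    simp [kernel, invFactorialSub, this]
  · simp [kernel, invFactorialSub, hm.ne']

/-- Removing a box from a part of `λ`. -/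
def lowerLabel : ℕ ⊕ ℕ → ℕ ⊕ ℕ
  | inl x => inl (x - 1)
  | inr m => inr m

/-- The indicator of the labels that belong to `λ`. -/
def isLeftLabel : ℕ ⊕ ℕ → ℚ
  | inl _ => 1
  | inr _ => 0

/-- The contribution of a label to `|λ| - |μ|`. -/
def labelWeight : ℕ ⊕ ℕ → ℚ
  | inl x => x
  | inr m => -m

/-- For two parts of `λ` this comes down to `x(x-1-y) + y(x-y+1) = (x-y)(x+y-1)`; for a mixed pair
it is `1/(x-1-m)! = (x-m)/(x-m)!`. The label `inl 0` is excluded because truncated subtraction would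
leave it fixed. -/
theorem kernel_lowerLabel {a b : ℕ ⊕ ℕ} (ha : a ≠ inl 0) (hb : b ≠ inl 0) :
    isLeftLabel a * kernel (lowerLabel a) b + isLeftLabel b * kernel a (lowerLabel b) =
      (labelWeight a + labelWeight b) * kernel a b := by
  have key : ∀ x m : ℕ, invFactorialSub x m = ((x + 1 : ℕ) - m : ℚ) * invFactorialSub (x + 1) m :=
    fun x m => by rw [invFactorialSub_succ]; push_cast; ring
  rcases a with x | m <;> rcases b with y | m'
  · obtain ⟨x, rfl⟩ := Nat.exists_eq_succ_of_ne_zero fun h : x = 0 => ha (by rw [h])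
    obtain ⟨y, rfl⟩ := Nat.exists_eq_succ_of_ne_zero fun h : y = 0 => hb (by rw [h])
    simp only [isLeftLabel, kernel, lowerLabel, labelWeight, Nat.succ_eq_add_one,
      Nat.add_sub_cancel, Nat.factorial_succ]
    have h1 : (x ! : ℚ) ≠ 0 := by positivity
    have h2 : (y ! : ℚ) ≠ 0 := by positivity
    have h3 : (x : ℚ) + 1 ≠ 0 := by positivity
    have h4 : (y : ℚ) + 1 ≠ 0 := by positivity
    have h5 : (x : ℚ) + (y + 1) ≠ 0 := by positivity
    have h6 : (x : ℚ) + 1 + y ≠ 0 := by positivity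
    have h7 : (x : ℚ) + 1 + (y + 1) ≠ 0 := by positivity
    push_cast
    field_simp
    ring
  · obtain ⟨x, rfl⟩ := Nat.exists_eq_succ_of_ne_zero fun h : x = 0 => ha (by rw [h])
    simp only [isLeftLabel, kernel, lowerLabel, labelWeight, Nat.succ_eq_add_one,
      Nat.add_sub_cancel]
    rw [key x m']
    ring
  · obtain ⟨y, rfl⟩ := Nat.exists_eq_succ_of_ne_zero fun h : y = 0 => hb (by rw [h])
    simp only [isLeftLabel, kernel, lowerLabel, labelWeight, Nat.succ_eq_add_one,
      Nat.add_sub_cancel]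
    rw [key y m]
    ring
  · simp [isLeftLabel, kernel]

/-- The labels of the rows of `A_{λ/μ}`, where `λ` has the parts `l 0, …, l (k - 1)` and `nu`
consists of the parts of `μ` in increasing order, possibly preceded by a zero. -/
def labels (l : ℕ → ℕ) (k : ℕ) (nu : List ℕ) : List (ℕ ⊕ ℕ) :=
  (List.range k).map (fun i => inl (l i)) ++ nu.map inr

theorem length_labels (l : ℕ → ℕ) (k : ℕ) (nu : List ℕ) :
    (labels l k nu).length = k + nu.length := by simp [labels]

theorem getD_labels_of_lt {l : ℕ → ℕ} {k i : ℕ} (nu : List ℕ) (h : i < k) :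
    (labels l k nu).getD i (inl 0) = inl (l i) := by
  rw [labels, List.getD_append _ _ _ _ (by simpa using h)]
  simp [h]

theorem getD_labels_add (l : ℕ → ℕ) {k i : ℕ} {nu : List ℕ} (h : i < nu.length) :
    (labels l k nu).getD (k + i) (inl 0) = inr (nu.getD i 0) := by
  rw [labels, List.getD_append_right _ _ _ _ (by simp)]
  simp [h]

theorem labels_update (l : ℕ → ℕ) {k i : ℕ} (nu : List ℕ) (h : i < k) :
    (labels l k nu).set i (lowerLabel ((labels l k nu).getD i (inl 0))) =
      labels (Function.update l i (l i - 1)) k nu := by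
  rw [getD_labels_of_lt nu h, labels, labels, List.set_append_left _ _ (by simpa using h)]
  congr 1
  refine List.ext_getElem (by simp) fun j h1 h2 => ?_
  rw [List.getElem_set]
  simp only [List.getElem_map, List.getElem_range]
  split_ifs with hij
  · subst hij
    simp [lowerLabel]
  · rw [Function.update_of_ne (Ne.symm hij)]

theorem labels_succ (l : ℕ → ℕ) (k : ℕ) (nu : List ℕ) :
    labels l (k + 1) nu = (List.range k).map (fun i => inl (l i)) ++ inl (l k) :: nu.map inr := by
  simp [labels, List.range_succ]

/-- The Pfaffian of the matrix with the given labels. -/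
noncomputable def labelPf (l : ℕ → ℕ) (k : ℕ) (nu : List ℕ) (n : ℕ) : ℚ :=
  listPf kernel (inl 0) n (labels l k nu)

theorem sum_labelPf_update {l : ℕ → ℕ} {k n : ℕ} {nu : List ℕ} (hn : k + nu.length = 2 * n)
    (hl : ∀ i < k, 0 < l i) :
    ∑ i ∈ Finset.range k, labelPf (Function.update l i (l i - 1)) k nu n =
      ((∑ i ∈ Finset.range k, l i : ℕ) - (nu.sum : ℚ)) * labelPf l k nu n := by
  have hne : ∀ a ∈ labels l k nu, a ≠ inl 0 := by
    intro a ha h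
    subst h
    simp only [labels, List.mem_append, List.mem_map, List.mem_range, Sum.inl.injEq,
      reduceCtorEq, and_false, exists_false, or_false] at ha
    obtain ⟨i, hi, h0⟩ := ha
    exact (hl i hi).ne' h0
  have key := sum_listPf_set (d := inl 0) kernel_skew isLeftLabel labelWeight lowerLabel
    ((length_labels l k nu).trans hn) fun a ha b hb => kernel_lowerLabel (hne a ha) (hne b hb)
  have hw : ((labels l k nu).map labelWeight).sum =
      (∑ i ∈ Finset.range k, l i : ℕ) - (nu.sum : ℚ) := by
    have h1 : ∀ k : ℕ, ((List.range k).map fun i => (l i : ℚ)).sum =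
        (∑ i ∈ Finset.range k, l i : ℕ) := by
      intro k
      induction k with
      | zero => simp
      | succ k ih => rw [Finset.sum_range_succ, List.range_succ]; simp [ih]
    have h2 : ∀ t : List ℕ, (t.map fun m : ℕ => -(m : ℚ)).sum = -(t.sum : ℚ) := by
      intro t
      induction t with
      | nil => simp
      | cons a t ih => rw [List.map_cons, List.sum_cons, ih]; simp; ring
    rw [labels, List.map_append, List.sum_append, List.map_map, List.map_map, sub_eq_add_neg,
      ← h1, ← h2]
    rfl
  rw [hw, ← hn, Finset.sum_range_add] at key
  rw [labelPf, ← key]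
  rw [Finset.sum_eq_zero (s := Finset.range nu.length), add_zero]
  · refine Finset.sum_congr rfl fun i hi => ?_
    have hi' := Finset.mem_range.1 hi
    rw [labels_update l nu hi', getD_labels_of_lt nu hi']
    simp [isLeftLabel, labelPf]
  · intro i hi
    rw [getD_labels_add l (Finset.mem_range.1 hi)]
    simp [isLeftLabel]

theorem labelPf_eq_zero_of_eq {l : ℕ → ℕ} {k n i j : ℕ} {nu : List ℕ}
    (hn : k + nu.length = 2 * n) (hij : i ≠ j) (hi : i < k) (hj : j < k) (h : l i = l j) :
    labelPf l k nu n = 0 :=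
  listPf_eq_zero_of_getD_eq kernel_skew hij (by omega) (by omega)
    (by rw [getD_labels_of_lt nu hi, getD_labels_of_lt nu hj, h])

/-- The Pfaffian vanishes if `i + 1` parts of `μ` exceed all but `i` parts of `λ`. -/
theorem labelPf_eq_zero_of_lt {l : ℕ → ℕ} {k n i : ℕ} {nu : List ℕ}
    (hn : k + nu.length = 2 * n) (hi : i < nu.length)
    (h : ∀ a, i ≤ a → a < k → ∀ b, b ≤ i → l a < nu.reverse.getD b 0) :
    labelPf l k nu n = 0 := by
  -- The last `i + 1` labels are the first `i + 1` entries of `nu.reverse`. Their only possible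
  -- partners are the first `i` parts of `λ`.
  refine listPf_eq_zero_of_card_lt kernel_skew (Finset.Ico (2 * n - 1 - i) (2 * n))
    (Finset.range i) (fun p hp => (Finset.mem_Ico.1 hp).2) ?_ ?_
  · rw [Finset.card_range, Nat.card_Ico]; omega
  · intro p hp q hq hqi
    rw [Finset.mem_Ico] at hp
    rw [Finset.mem_range, not_lt] at hqi
    obtain ⟨p, rfl⟩ : ∃ e, p = k + e := ⟨p - k, by omega⟩
    rw [getD_labels_add l (by omega)]
    rcases lt_or_ge q k with hqk | hqk
    · rw [getD_labels_of_lt nu hqk]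
      have := h q hqi hqk (nu.length - 1 - p) (by omega)
      rw [List.getD_eq_getElem _ _ (by simp; omega), List.getElem_reverse] at this
      rw [kernel, invFactorialSub_of_lt, neg_zero]
      rw [List.getD_eq_getElem _ _ (by omega)]
      convert this using 2
      omega
    · obtain ⟨q, rfl⟩ := Nat.exists_eq_add_of_le hqk
      rw [getD_labels_add l (by omega)]
      rfl

/-- A zero part of `λ` may be shifted to `μ`. -/
theorem labelPf_succ {l : ℕ → ℕ} {k n : ℕ} {nu : List ℕ} (hn : k + 1 + nu.length = 2 * n)
    (hl : ∀ i < k, 0 < l i) (hk : l k = 0) (hnu : ∀ m ∈ nu, 0 < m) :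
    labelPf l (k + 1) nu n = labelPf l k (0 :: nu) n := by
  rw [labelPf, labels_succ, hk, labelPf, labels]
  refine listPf_congr_of_forall_mem kernel_skew (by simp; omega) fun z hz => kernel_inl_zero ?_
  simp only [List.mem_append, List.mem_map, List.mem_range] at hz
  rcases hz with ⟨i, hi, rfl⟩ | ⟨m, hm, rfl⟩
  · exact Or.inl ⟨_, hl i hi, rfl⟩
  · exact Or.inr ⟨_, hnu m hm, rfl⟩

/-- A zero part of `λ` and a zero part of `μ` cancel. -/
theorem labelPf_succ_cons_zero {l : ℕ → ℕ} {k n : ℕ} {nu : List ℕ}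
    (hn : k + nu.length = 2 * n) (hl : ∀ i < k, 0 < l i) (hk : l k = 0)
    (hnu : ∀ m ∈ nu, 0 < m) :
    labelPf l (k + 1) (0 :: nu) (n + 1) = labelPf l k nu n := by
  rw [labelPf, labels_succ, hk, labelPf, labels, List.map_cons,
    listPf_append_pair kernel_skew (by simp; omega)]
  · simp [kernel, invFactorialSub_self]
  · intro z hz
    refine kernel_inl_zero ?_
    simp only [List.mem_append, List.mem_map, List.mem_range] at hz
    rcases hz with ⟨i, hi, rfl⟩ | ⟨m, hm, rfl⟩
    · exact Or.inl ⟨_, hl i hi, rfl⟩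
    · exact Or.inr ⟨_, hnu m hm, rfl⟩

/-- The largest part on the `μ` side can only be matched with its equal on the `λ` side, as
`1/(x-a)! = 0` for `x < a`. By induction only the nested matching survives; listing `μ` in
increasing order makes its sign `+1`. -/
theorem listPf_nested {p : List ℕ} (hp : p.Pairwise (· > ·)) :
    listPf kernel (inl 0) p.length (p.map inl ++ p.reverse.map inr) = 1 := by
  induction p with
  | nil => simp [listPf, pfaffian]
  | cons a p ih =>
    rw [List.pairwise_cons] at hp
    have : (a :: p).map inl ++ (a :: p).reverse.map inr =
        inl a :: ((p.map inl ++ p.reverse.map inr) ++ [inr a]) := by simp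
    rw [this, List.length_cons, listPf_cons_append_singleton kernel_skew
      (by simp; omega), ih hp.2]
    · simp [kernel, invFactorialSub_self]
    · intro z hz
      simp only [List.mem_append, List.mem_map, List.mem_reverse] at hz
      rcases hz with ⟨x, hx, rfl⟩ | ⟨m, hm, rfl⟩
      · rw [kernel, invFactorialSub_of_lt (hp.1 x hx), neg_zero]
      · rfl

end StrictPartition

/-! ### Standard fillings and removal of the largest entry -/

section Fillings

open Set

/-- The fillings of the boxes in `D` by `1, …, N`, each used once, that increase along rows and
down columns; they are extended by `0` outside `D`. -/
def standardFillings (D : Set (ℕ × ℕ)) (N : ℕ) : Set (ℕ × ℕ → ℕ) :=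
  {f | (∀ b ∉ D, f b = 0) ∧ BijOn f D (Icc 1 N) ∧
    (∀ b ∈ D, (b.1 + 1, b.2) ∈ D → f b < f (b.1 + 1, b.2)) ∧
    ∀ b ∈ D, (b.1, b.2 + 1) ∈ D → f b < f (b.1, b.2 + 1)}

/-- The boxes of `D` without a neighbour in `D` below or to the right. -/
def outerCorners (D : Set (ℕ × ℕ)) : Set (ℕ × ℕ) :=
  {c ∈ D | (c.1 + 1, c.2) ∉ D ∧ (c.1, c.2 + 1) ∉ D}

theorem standardFillings_empty : standardFillings ∅ 0 = {0} := by
  ext f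
  simp [standardFillings, funext_iff]

theorem standardFillings_zero_finite (D : Set (ℕ × ℕ)) : (standardFillings D 0).Finite := by
  refine (finite_singleton (0 : ℕ × ℕ → ℕ)).subset fun f hf => ?_
  ext b
  by_cases hb : b ∈ D
  · have := hf.2.1.mapsTo hb
    simp at this
  · exact hf.1 b hb

theorem update_mem_standardFillings {D : Set (ℕ × ℕ)} {N : ℕ} {c : ℕ × ℕ}
    (hc : c ∈ outerCorners D) {f : ℕ × ℕ → ℕ} (hf : f ∈ standardFillings (D \ {c}) N) :
    Function.update f c (N + 1) ∈ standardFillings D (N + 1) := by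
  obtain ⟨h0, hb, h1, h2⟩ := hf
  obtain ⟨hcD, hc1, hc2⟩ := hc
  have hof : ∀ b ∈ D, b ≠ c → Function.update f c (N + 1) b = f b := fun b _ h =>
    Function.update_of_ne h _ _
  have hle : ∀ b ∈ D, b ≠ c → f b < N + 1 := fun b hb' h =>
    Nat.lt_succ_of_le (hb.mapsTo ⟨hb', h⟩).2
  refine ⟨fun b hbD => ?_, ?_, fun b hbD hb' => ?_, fun b hbD hb' => ?_⟩
  · have : b ≠ c := fun h => hbD (h ▸ hcD)
    rw [Function.update_of_ne this]
    exact h0 b fun h => hbD h.1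
  · have e1 : BijOn (Function.update f c (N + 1)) (D \ {c}) (Icc 1 N) :=
      hb.congr fun b hb => (hof b hb.1 hb.2).symm
    have e2 := e1.insert (a := c) (by simp)
    rw [Function.update_self, insert_sdiff_singleton, insert_eq_of_mem hcD] at e2
    convert e2 using 1
    ext x
    simp only [mem_Icc, mem_insert_iff]
    omega
  · have hbc : b ≠ c := fun h => hc1 (h ▸ hb')
    rw [hof b hbD hbc]
    by_cases h : (b.1 + 1, b.2) = c
    · rw [h, Function.update_self]
      exact hle b hbD hbc
    · rw [hof _ hb' h]
      exact h1 b ⟨hbD, hbc⟩ ⟨hb', h⟩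
  · have hbc : b ≠ c := fun h => hc2 (h ▸ hb')
    rw [hof b hbD hbc]
    by_cases h : (b.1, b.2 + 1) = c
    · rw [h, Function.update_self]
      exact hle b hbD hbc
    · rw [hof _ hb' h]
      exact h2 b ⟨hbD, hbc⟩ ⟨hb', h⟩

/-- The box holding `N + 1` is an outer corner, since a neighbour below or to the right would need a
larger entry. Resetting it to `0` gives a filling of the smaller shape. -/
theorem exists_update_eq {D : Set (ℕ × ℕ)} {N : ℕ} {f : ℕ × ℕ → ℕ}
    (hf : f ∈ standardFillings D (N + 1)) :
    ∃ c ∈ outerCorners D, ∃ g ∈ standardFillings (D \ {c}) N,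
      Function.update g c (N + 1) = f := by
  obtain ⟨h0, hb, h1, h2⟩ := hf
  obtain ⟨c, hcD, hc⟩ := hb.surjOn (show N + 1 ∈ Icc 1 (N + 1) by simp)
  have hle : ∀ b ∈ D, f b ≤ N + 1 := fun b hbD => (hb.mapsTo hbD).2
  have hof : ∀ b ∈ D \ {c}, Function.update f c 0 b = f b := fun b hb =>
    Function.update_of_ne hb.2 _ _
  refine ⟨c, ⟨hcD, fun h => ?_, fun h => ?_⟩, Function.update f c 0, ⟨fun b hbD => ?_, ?_,
    fun b hbD hb' => ?_, fun b hbD hb' => ?_⟩, ?_⟩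
  · have := h1 c hcD h
    have := hle _ h
    omega
  · have := h2 c hcD h
    have := hle _ h
    omega
  · by_cases hbc : b = c
    · rw [hbc, Function.update_self]
    · rw [Function.update_of_ne hbc]
      exact h0 b fun h => hbD ⟨h, hbc⟩
  · have e := hb.sdiff_singleton hcD
    rw [hc] at e
    have : Icc 1 (N + 1) \ {N + 1} = Icc 1 N := by
      ext x
      simp only [mem_sdiff, mem_Icc, mem_singleton_iff]
      omega
    rw [this] at e
    exact e.congr fun b hb => (hof b hb).symm
  · rw [hof _ hbD, hof _ hb']
    exact h1 b hbD.1 hb'.1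
  · rw [hof _ hbD, hof _ hb']
    exact h2 b hbD.1 hb'.1
  · rw [Function.update_idem, ← hc, Function.update_eq_self]

theorem standardFillings_succ (D : Set (ℕ × ℕ)) (N : ℕ) :
    standardFillings D (N + 1) = ⋃ c ∈ outerCorners D,
      (fun f => Function.update f c (N + 1)) '' standardFillings (D \ {c}) N := by
  ext f
  simp only [mem_iUnion, mem_image, exists_prop]
  refine ⟨exists_update_eq, ?_⟩
  rintro ⟨c, hc, g, hg, rfl⟩
  exact update_mem_standardFillings hc hg

theorem standardFillings_finite {D : Set (ℕ × ℕ)} (hD : D.Finite) (N : ℕ) :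
    (standardFillings D N).Finite := by
  induction N generalizing D with
  | zero => exact standardFillings_zero_finite D
  | succ N ih =>
    rw [standardFillings_succ]
    exact (hD.subset fun c hc => hc.1).biUnion fun c _ => (ih hD.sdiff).image _

theorem ncard_standardFillings_succ {ι : Type*} {D : Set (ℕ × ℕ)} (hD : D.Finite) (N : ℕ)
    (s : Finset ι) (c : ι → ℕ × ℕ) (hc : BijOn c s (outerCorners D)) :
    (standardFillings D (N + 1)).ncard = ∑ i ∈ s, (standardFillings (D \ {c i}) N).ncard := by
  have hinj : ∀ c, InjOn (fun f : ℕ × ℕ → ℕ => Function.update f c (N + 1))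
      (standardFillings (D \ {c}) N) := by
    intro c f hf g hg h
    ext b
    by_cases hb : b = c
    · rw [hb, hf.1 c (by simp), hg.1 c (by simp)]
    · simpa [Function.update_of_ne hb] using congrFun h b
  have hfin : ∀ i ∈ s, ((fun f : ℕ × ℕ → ℕ => Function.update f (c i) (N + 1)) ''
      standardFillings (D \ {c i}) N).Finite := fun i _ =>
    (standardFillings_finite hD.sdiff N).image _
  rw [standardFillings_succ, ← hc.image_eq, biUnion_image,
    s.finite_toSet.ncard_biUnion hfin, finsum_mem_coe_finset]
  · exact Finset.sum_congr rfl fun i _ => (hinj (c i)).ncard_image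
  · intro i hi j hj hij
    rw [Function.onFun, Set.disjoint_left]
    rintro f ⟨g, hg, rfl⟩ ⟨g', -, h⟩
    -- A common filling would have `N + 1` at `c j`, where `g` takes a value at most `N`.
    have hne : c j ≠ c i := fun h => hij (hc.injOn hi hj h.symm)
    have h1 := congrFun h (c j)
    simp only [Function.update_self, Function.update_of_ne hne] at h1
    have h2 := (hg.2.1.mapsTo ⟨(hc.mapsTo hj).1, hne⟩).2
    omega

end Fillings

/-! ### Skew shifted shapes as sequences of row lengths -/

namespace StrictPartition

/-- The boxes of the skew shifted diagram between the sequences of row lengths `m` and `l`. -/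
def skewCells (l m : ℕ → ℕ) : Set (ℕ × ℕ) :=
  {b | b.1 + m b.1 ≤ b.2 ∧ b.2 < b.1 + l b.1}

theorem skewCells_self (l : ℕ → ℕ) : skewCells l l = ∅ := by
  ext b
  simp [skewCells]

theorem skewCells_finite {l : ℕ → ℕ} {k : ℕ} (hk : ∀ i, 0 < l i ↔ i < k) (m : ℕ → ℕ) :
    (skewCells l m).Finite := by
  refine ((Finset.range k).finite_toSet.biUnion fun i _ =>
    ((Finset.range (i + l i)).finite_toSet.image fun j => (i, j))).subset ?_
  rintro ⟨i, j⟩ ⟨h1, h2⟩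
  simp only [Set.mem_iUnion, Set.mem_image, Finset.mem_coe, Finset.mem_range, exists_prop]
  simp only at h1 h2
  exact ⟨i, (hk i).1 (by omega), j, h2, rfl⟩

/-- The last box of the row `i` may be removed from `l`, keeping the parts distinct and the
shape over `m`. -/
def IsRemovable (l m : ℕ → ℕ) (i : ℕ) : Prop :=
  m i < l i ∧ (l (i + 1) + 1 < l i ∨ l i = 1)

/-- With truncated subtraction, `hl` says that `l` decreases strictly until it reaches `0` and then
stays there. The box below the end of row `i` is absent if row `i + 1` is too short, or if it starts
too far to the right; strictness of `m` restricts the second case to `l i = 1`, where the whole row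
disappears. -/
theorem bijOn_outerCorners {l m : ℕ → ℕ} (hl : ∀ i, l (i + 1) ≤ l i - 1)
    (hm : ∀ i, m (i + 1) ≤ m i - 1) :
    Set.BijOn (fun i => (i, i + l i - 1)) {i | IsRemovable l m i}
      (outerCorners (skewCells l m)) := by
  refine ⟨?_, fun i _ j _ h => congrArg Prod.fst h, ?_⟩
  · rintro i ⟨h1, h2⟩
    have := hl i
    simp only [outerCorners, skewCells, Set.mem_ofPred_eq]
    omega
  · rintro ⟨i, j⟩ ⟨⟨h1, h2⟩, h3, h4⟩
    have := hl i
    have := hm i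
    simp only [skewCells, Set.mem_ofPred_eq] at h1 h2 h3 h4
    refine ⟨i, ⟨by omega, by omega⟩, ?_⟩
    simp only [Prod.mk.injEq, true_and]
    omega

theorem skewCells_sdiff {l : ℕ → ℕ} (m : ℕ → ℕ) {i : ℕ} (hi : 0 < l i) :
    skewCells l m \ {(i, i + l i - 1)} = skewCells (Function.update l i (l i - 1)) m := by
  ext ⟨a, b⟩
  simp only [skewCells, Set.mem_sdiff, Set.mem_ofPred_eq, Set.mem_singleton_iff, Prod.mk.injEq]
  by_cases h : a = i
  · subst h
    rw [Function.update_self]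
    omega
  · rw [Function.update_of_ne h]
    simp [h]

end StrictPartition

/-! ### The recursion for the Pfaffian and the induction -/

namespace StrictPartition

open Sum

section Parts

variable (mu : StrictPartition)

theorem part_of_lt {i : ℕ} (h : i < mu.length) : mu.part i = mu.parts[i] :=
  List.getD_eq_getElem _ _ h

theorem part_of_ge {i : ℕ} (h : mu.length ≤ i) : mu.part i = 0 :=
  List.getD_eq_default _ _ h

theorem part_pos_iff (i : ℕ) : 0 < mu.part i ↔ i < mu.length := by
  rcases lt_or_ge i mu.length with h | h
  · rw [mu.part_of_lt h]
    exact ⟨fun _ => h, fun _ => mu.pos _ (List.getElem_mem _)⟩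
  · rw [mu.part_of_ge h]
    omega

theorem part_succ_le (i : ℕ) : mu.part (i + 1) ≤ mu.part i - 1 := by
  rcases lt_or_ge (i + 1) mu.length with h | h
  · rw [mu.part_of_lt h, mu.part_of_lt (by omega)]
    have := List.pairwise_iff_getElem.1 mu.strict i (i + 1) (by unfold length at h; omega) h
      (by omega)
    omega
  · rw [mu.part_of_ge h]
    omega

theorem antitone_part : Antitone mu.part :=
  antitone_nat_of_succ_le fun i => (mu.part_succ_le i).trans (Nat.sub_le _ _)

theorem map_range_part {β : Type*} (f : ℕ → β) :
    (List.range mu.length).map (fun i => f (mu.part i)) = mu.parts.map f := by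
  refine List.ext_getElem (by simp [length]) fun i h1 h2 => ?_
  simp only [List.getElem_map, List.getElem_range]
  rw [mu.part_of_lt (by simpa using h1)]
  rfl

theorem sum_part {k : ℕ} (hk : mu.length ≤ k) : ∑ i ∈ Finset.range k, mu.part i = mu.size := by
  obtain ⟨e, rfl⟩ := Nat.exists_eq_add_of_le hk
  rw [Finset.sum_range_add, Finset.sum_eq_zero (s := Finset.range e)
    fun i _ => mu.part_of_ge (by omega), add_zero, Finset.sum_range]
  rw [size, ← Fin.sum_univ_getElem]
  exact Finset.sum_congr rfl fun i _ => mu.part_of_lt i.2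

end Parts

/-- The parts of `μ` in increasing order, preceded by a zero if `k + ℓ(μ)` is odd. -/
def paddedReverse (mu : StrictPartition) (k : ℕ) : List ℕ :=
  if Even (k + mu.length) then mu.parts.reverse else 0 :: mu.parts.reverse

theorem sum_paddedReverse (mu : StrictPartition) (k : ℕ) : (mu.paddedReverse k).sum = mu.size := by
  unfold paddedReverse
  split_ifs <;> simp [size]

theorem add_length_paddedReverse (mu : StrictPartition) (k : ℕ) :
    k + (mu.paddedReverse k).length = 2 * ((k + mu.length + 1) / 2) := by
  unfold paddedReverse
  split_ifs with h <;> rw [Nat.even_iff] at h <;>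
    simp only [length, List.length_reverse, List.length_cons] at * <;> omega

theorem length_le_length_paddedReverse (mu : StrictPartition) (k : ℕ) :
    mu.length ≤ (mu.paddedReverse k).length := by
  unfold paddedReverse
  split_ifs <;> simp [length]

theorem getD_reverse_paddedReverse (mu : StrictPartition) (k : ℕ) {b : ℕ} (hb : b < mu.length) :
    (mu.paddedReverse k).reverse.getD b 0 = mu.part b := by
  unfold paddedReverse
  split_ifs
  · rw [List.reverse_reverse, part]
  · rw [List.reverse_cons, List.reverse_reverse, List.getD_append _ _ _ _ hb, part]

/-- The Pfaffian of `A_{λ/μ}` for `λ` with the parts `l 0, …, l (k - 1)`. -/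
noncomputable def skewPf (mu : StrictPartition) (l : ℕ → ℕ) (k : ℕ) : ℚ :=
  labelPf l k (mu.paddedReverse k) ((k + mu.length + 1) / 2)

theorem pos_of_mem_reverse (mu : StrictPartition) : ∀ m ∈ mu.parts.reverse, 0 < m := fun m hm =>
  mu.pos m (List.mem_reverse.1 hm)

/-- A last part equal to zero may be dropped. -/
theorem skewPf_of_part_eq_zero (mu : StrictPartition) {l : ℕ → ℕ} {k : ℕ}
    (hl : ∀ i < k, 0 < l i) (hk : l k = 0) :
    labelPf l (k + 1) (mu.paddedReverse (k + 1)) ((k + 1 + mu.length + 1) / 2) =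
      mu.skewPf l k := by
  have hlen := add_length_paddedReverse mu
  rw [skewPf]
  by_cases h : Even (k + mu.length)
  · have h' : ¬ Even (k + 1 + mu.length) := by rw [Nat.even_iff] at *; omega
    have h1 := hlen k
    rw [paddedReverse, if_pos h] at h1
    rw [paddedReverse, paddedReverse, if_neg h', if_pos h]
    have : (k + 1 + mu.length + 1) / 2 = (k + mu.length + 1) / 2 + 1 := by
      rw [Nat.even_iff] at *; omega
    rw [this]
    exact labelPf_succ_cons_zero h1 hl hk mu.pos_of_mem_reverse
  · have h' : Even (k + 1 + mu.length) := by rw [Nat.even_iff] at *; omega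
    have h1 := hlen (k + 1)
    rw [paddedReverse, if_pos h'] at h1
    rw [paddedReverse, paddedReverse, if_pos h', if_neg h]
    rw [labelPf_succ h1 hl hk mu.pos_of_mem_reverse]
    congr 1
    rw [Nat.even_iff] at *; omega

theorem skewPf_self (mu : StrictPartition) : mu.skewPf mu.part mu.length = 1 := by
  have h : Even (mu.length + mu.length) := ⟨_, rfl⟩
  have hn : (mu.length + mu.length + 1) / 2 = mu.parts.length := by unfold length; omega
  rw [skewPf, paddedReverse, if_pos h, hn, labelPf, labels, map_range_part]
  exact listPf_nested mu.strict

/-- The number of parts that remain after removing a box from the row `i`. -/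
def remainingLength (l : ℕ → ℕ) (k i : ℕ) : ℕ := if l i = 1 then k - 1 else k

theorem antitone_of_succ_le {l : ℕ → ℕ} (hl : ∀ i, l (i + 1) ≤ l i - 1) : Antitone l :=
  antitone_nat_of_succ_le fun i => (hl i).trans (Nat.sub_le _ _)

theorem last_of_eq_one {l : ℕ → ℕ} {k i : ℕ} (hl : ∀ i, l (i + 1) ≤ l i - 1)
    (hk : ∀ i, 0 < l i ↔ i < k) (h : l i = 1) : k = i + 1 := by
  have h1 := hl i
  have h2 := hk i
  have h3 := hk (i + 1)
  omega

-- This is the Pfaffian counterpart of corner removal: in `sum_labelPf_update` the rows without a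
-- removable box contribute nothing.
open Classical in
theorem mul_skewPf (mu : StrictPartition) {l : ℕ → ℕ} {k N : ℕ} (hl : ∀ i, l (i + 1) ≤ l i - 1)
    (hk : ∀ i, 0 < l i ↔ i < k) (hmu : ∀ i, mu.part i ≤ l i)
    (hN : ∑ i ∈ Finset.range k, l i = mu.size + (N + 1)) :
    ((N : ℚ) + 1) * mu.skewPf l k = ∑ i ∈ Finset.range k with IsRemovable l mu.part i,
      mu.skewPf (Function.update l i (l i - 1)) (remainingLength l k i) := by
  have key := sum_labelPf_update (add_length_paddedReverse mu k) fun i hi => (hk i).2 hi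
  rw [sum_paddedReverse, hN] at key
  have e : ((mu.size + (N + 1) : ℕ) : ℚ) - mu.size = (N : ℚ) + 1 := by push_cast; ring
  rw [e] at key
  rw [skewPf, ← key, Finset.sum_filter]
  refine Finset.sum_congr rfl fun i hi => ?_
  have hik := Finset.mem_range.1 hi
  have hpos := (hk i).2 hik
  have hli := hl i
  split_ifs with hr
  · rw [remainingLength]
    split_ifs with h1
    · obtain rfl := last_of_eq_one hl hk h1
      rw [Nat.add_sub_cancel]
      refine skewPf_of_part_eq_zero mu (fun j hj => ?_) (by simp [h1])
      rw [Function.update_of_ne hj.ne]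
      exact (hk j).2 (by omega)
    · rfl
  · have hmui := hmu i
    -- If row `i` already ends at `μ`, lowering it leaves the parts `0, …, i` of `μ` larger than
    -- every part of `λ` from row `i` on. Otherwise lowering it makes the rows `i` and `i + 1`
    -- equal.
    rcases eq_or_lt_of_le hmui with hm | hm
    · have him : i < mu.length := (mu.part_pos_iff i).1 (by omega)
      refine labelPf_eq_zero_of_lt (i := i) (add_length_paddedReverse mu k)
        (him.trans_le (length_le_length_paddedReverse mu k)) fun a hia hak b hbi => ?_
      rw [getD_reverse_paddedReverse mu k (by omega)]
      have h1 := mu.antitone_part hbi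
      rcases eq_or_lt_of_le hia with rfl | hia
      · rw [Function.update_self]
        omega
      · rw [Function.update_of_ne hia.ne']
        have h2 := antitone_of_succ_le hl (show i + 1 ≤ a from hia)
        omega
    · have h1 : l (i + 1) = l i - 1 ∧ l i ≠ 1 := by
        by_contra h
        exact hr ⟨hm, by omega⟩
      have h2 : i + 1 < k := (hk (i + 1)).1 (by omega)
      refine labelPf_eq_zero_of_eq (add_length_paddedReverse mu k) (Nat.succ_ne_self i).symm
        hik h2 ?_
      rw [Function.update_self, Function.update_of_ne (by omega), h1.1]

theorem eq_of_sum_eq (mu : StrictPartition) {l : ℕ → ℕ} {k : ℕ}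
    (hk : ∀ i, 0 < l i ↔ i < k) (hmu : ∀ i, mu.part i ≤ l i)
    (hN : ∑ i ∈ Finset.range k, l i = mu.size) : l = mu.part ∧ k = mu.length := by
  have hlen : mu.length ≤ k := by
    by_contra! h
    have h1 := (mu.part_pos_iff k).2 h
    have h2 := hmu k
    have h3 := hk k
    omega
  have hl : l = mu.part := by
    funext i
    rcases lt_or_ge i k with hi | hi
    · rw [← mu.sum_part hlen] at hN
      exact ((Finset.sum_eq_sum_iff_of_le fun i _ => hmu i).1 hN.symm i
        (Finset.mem_range.2 hi)).symm
    · have h1 := hk i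
      rw [mu.part_of_ge (hlen.trans hi)]
      omega
  refine ⟨hl, le_antisymm ?_ hlen⟩
  by_contra! h
  have h1 := (hk mu.length).2 h
  rw [hl, mu.part_of_ge le_rfl] at h1
  omega

theorem ncard_standardFillings_skewCells (mu : StrictPartition) {N : ℕ} {l : ℕ → ℕ} {k : ℕ}
    (hl : ∀ i, l (i + 1) ≤ l i - 1) (hk : ∀ i, 0 < l i ↔ i < k) (hmu : ∀ i, mu.part i ≤ l i)
    (hN : ∑ i ∈ Finset.range k, l i = mu.size + N) :
    ((standardFillings (skewCells l mu.part) N).ncard : ℚ) = (N ! : ℚ) * mu.skewPf l k := by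
  classical
  induction N generalizing l k with
  | zero =>
    obtain ⟨rfl, rfl⟩ := mu.eq_of_sum_eq hk hmu hN
    rw [skewPf_self, skewCells_self, standardFillings_empty]
    simp
  | succ N ih =>
    have hbij : Set.BijOn (fun i => (i, i + l i - 1))
        ((Finset.range k).filter fun i => IsRemovable l mu.part i)
        (outerCorners (skewCells l mu.part)) := by
      convert bijOn_outerCorners hl mu.part_succ_le using 1
      ext i
      simp only [Finset.coe_filter, Finset.mem_range, Set.mem_ofPred_eq, and_iff_right_iff_imp]
      exact fun h => (hk i).1 (by have := h.1; omega)
    rw [ncard_standardFillings_succ (skewCells_finite hk _) N _ _ hbij, Nat.factorial_succ]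
    push_cast
    rw [mul_comm ((N : ℚ) + 1), mul_assoc, mul_skewPf mu hl hk hmu hN, Finset.mul_sum]
    refine Finset.sum_congr rfl fun i hi => ?_
    obtain ⟨hik, hr1, hr2⟩ := Finset.mem_filter.1 hi
    have hik := Finset.mem_range.1 hik
    have hpos := (hk i).2 hik
    rw [skewCells_sdiff _ hpos]
    have hsum : ∑ j ∈ Finset.range k, Function.update l i (l i - 1) j = mu.size + N := by
      have h1 := Finset.sum_update_of_mem (Finset.mem_range.2 hik) l (l i - 1)
      have h3 := Finset.add_sum_erase (Finset.range k) l (Finset.mem_range.2 hik)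
      rw [Finset.sdiff_singleton_eq_erase] at h1
      omega
    -- The lowered sequence is again a strict partition containing `μ`. A part equal to `1` is the
    -- last one, so its removal only shortens the range to `k - 1`.
    refine ih (fun j => ?_) (fun j => ?_) (fun j => ?_) ?_
    · have := hl j
      simp only [Function.update_apply]
      split_ifs with h1 h2 h2
      · omega
      · rw [h1] at this; omega
      · subst h2; omega
      · exact this
    · have h1 := hk j
      rw [remainingLength, Function.update_apply]
      split_ifs with h2 h3 h3
      · have := last_of_eq_one hl hk h3
        omega
      · subst h2; omega
      · have := last_of_eq_one hl hk h3
        omega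
      · exact h1
    · rw [Function.update_apply]
      split_ifs with h1
      · subst h1; omega
      · exact hmu j
    · rw [remainingLength]
      split_ifs with h1
      · have h2 := last_of_eq_one hl hk h1
        subst h2
        rw [Finset.sum_range_succ, Function.update_self, h1] at hsum
        simpa [h1] using hsum
      · exact hsum

end StrictPartition

/-! ### Translation to tableaux and to the matrix `A_{λ/μ}` -/

namespace StrictPartition

open Sum

theorem mem_shiftedDiagram (lam : StrictPartition) (i j : ℕ) :
    (i, j) ∈ lam.shiftedDiagram ↔ i ≤ j ∧ j < i + lam.part i := by
  have := lam.part_pos_iff i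
  simp only [shiftedDiagram, Set.mem_ofPred_eq]
  omega

theorem skewDiagram_eq (lam mu : StrictPartition) :
    lam.skewDiagram mu = skewCells lam.part mu.part := by
  ext ⟨i, j⟩
  rw [skewDiagram, Set.mem_sdiff, mem_shiftedDiagram, mem_shiftedDiagram]
  simp only [skewCells, Set.mem_ofPred_eq]
  omega

theorem part_le_of_subset {lam mu : StrictPartition}
    (h : mu.shiftedDiagram ⊆ lam.shiftedDiagram) (i : ℕ) : mu.part i ≤ lam.part i := by
  by_contra! hlt
  have h1 : (i, i + lam.part i) ∈ mu.shiftedDiagram := by rw [mem_shiftedDiagram]; omega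
  have h2 := h h1
  rw [mem_shiftedDiagram] at h2
  omega

/-- Extension by zero puts the tableaux of all shapes into one function type, so that the induction
can change the shape without transporting equivalences. -/
theorem skewDim_eq (lam mu : StrictPartition) :
    lam.skewDim mu =
      (standardFillings (lam.skewDiagram mu) (lam.size - mu.size)).ncard := by
  classical
  let N := lam.size - mu.size
  let D := lam.skewDiagram mu
  let Φ : (D ≃ Finset.Icc 1 N) → ℕ × ℕ → ℕ := fun T b => if h : b ∈ D then (T ⟨b, h⟩ : ℕ) else 0
  have hΦ : ∀ T (b : D), Φ T b = T b := fun T b => dif_pos b.2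
  have hinj : Function.Injective Φ := by
    intro T T' h
    ext b
    rw [← hΦ, ← hΦ, h]
  have himage : Φ '' lam.standardShiftedTableaux mu = standardFillings D N := by
    ext f
    constructor
    · rintro ⟨T, ⟨h1, h2⟩, rfl⟩
      refine ⟨fun b hb => dif_neg hb, ⟨?_, ?_, ?_⟩, fun b hb hb' => ?_, fun b hb hb' => ?_⟩
      · intro b hb
        rw [hΦ T ⟨b, hb⟩]
        exact Finset.mem_Icc.1 (T ⟨b, hb⟩).2
      · intro b hb c hc h
        rw [hΦ T ⟨b, hb⟩, hΦ T ⟨c, hc⟩] at h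
        exact congrArg Subtype.val (T.injective (Subtype.ext h))
      · intro x hx
        obtain ⟨b, hb⟩ := T.surjective ⟨x, Finset.mem_Icc.2 hx⟩
        exact ⟨b, b.2, by rw [hΦ, hb]⟩
      · rw [hΦ T ⟨b, hb⟩, hΦ T ⟨_, hb'⟩]
        exact h1 ⟨b, hb⟩ ⟨_, hb'⟩ rfl
      · rw [hΦ T ⟨b, hb⟩, hΦ T ⟨_, hb'⟩]
        exact h2 ⟨b, hb⟩ ⟨_, hb'⟩ rfl
    · rintro ⟨h0, hb, h1, h2⟩
      let T : D ≃ Finset.Icc 1 N := Equiv.ofBijective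
        (fun b => ⟨f b, Finset.mem_Icc.2 (hb.mapsTo b.2)⟩)
        ⟨fun b c h => Subtype.ext (hb.injOn b.2 c.2 (congrArg Subtype.val h)), fun x => by
          obtain ⟨b, hbD, hbx⟩ := hb.surjOn (Finset.mem_Icc.1 x.2)
          exact ⟨⟨b, hbD⟩, Subtype.ext hbx⟩⟩
      have hT : ∀ b : D, (T b : ℕ) = f b := fun b => rfl
      refine ⟨T, ⟨fun b c hc => ?_, fun b c hc => ?_⟩, ?_⟩
      · rw [← Subtype.coe_lt_coe, hT, hT, hc]
        exact h1 b b.2 (hc ▸ c.2)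
      · rw [← Subtype.coe_lt_coe, hT, hT, hc]
        exact h2 b b.2 (hc ▸ c.2)
      · ext b
        by_cases hbD : b ∈ D
        · rw [hΦ T ⟨b, hbD⟩, hT]
        · rw [h0 b hbD]
          exact dif_neg hbD
  rw [skewDim, ← himage, Set.ncard_image_of_injective _ hinj]

theorem pfaffian_matA_eq_listPf (lam mu : StrictPartition) :
    pfaffian (lam.matA mu) = listPf kernel (inl 0) ((lam.length + mu.length + 1) / 2)
      ((lam.paddedParts mu).map inl ++ mu.parts.reverse.map inr) := by
  unfold listPf
  congr 1
  let e := finSumFinEquiv.trans (finCongr (length_paddedParts_add lam mu))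
  let L := (lam.paddedParts mu).map inl ++ mu.parts.reverse.map (inr : ℕ → ℕ ⊕ ℕ)
  have h1 : ∀ i, L.getD (e (inl i)) (inl 0) = inl ((lam.paddedParts mu).get i) := by
    intro i
    have : (e (inl i) : ℕ) = i := by simp [e]
    rw [this, List.getD_append _ _ _ _ (by simp)]
    simp
  have h2 : ∀ j, L.getD (e (inr j)) (inl 0) = inr (mu.part j.rev) := by
    intro j
    have : (e (inr j) : ℕ) = (lam.paddedParts mu).length + j := by simp [e]
    have hj : (j : ℕ) < mu.parts.length := j.2
    rw [this, List.getD_append_right _ _ _ _ (by simp), mu.part_of_lt j.rev.2,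
      List.getD_eq_getElem _ _ (by simpa using hj), List.getElem_map, List.getElem_reverse]
    congr 2
    have hr : (j.rev : ℕ) = mu.parts.length - (j + 1) := Fin.val_rev j
    rw [hr]
    simp
    omega
  ext p q
  obtain ⟨p, rfl⟩ := e.surjective p
  obtain ⟨q, rfl⟩ := e.surjective q
  change Matrix.fromBlocks _ _ _ _ (e.symm (e p)) (e.symm (e q)) =
    kernel (L.getD (e p) (inl 0)) (L.getD (e q) (inl 0))
  rw [Equiv.symm_apply_apply, Equiv.symm_apply_apply]
  rcases p with i | i <;> rcases q with j | j <;> simp only [h1, h2] <;> rfl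

/-- In the odd case `matA` appends the zero to `λ`, while `skewPf` puts it in front of the reversed
`μ`. It occupies the same place in the list of labels, and `labelPf_succ` exchanges its two roles.
-/
theorem pfaffian_matA (lam mu : StrictPartition) :
    pfaffian (lam.matA mu) = mu.skewPf lam.part lam.length := by
  rw [pfaffian_matA_eq_listPf, skewPf]
  by_cases h : Even (lam.length + mu.length)
  · rw [paddedParts, if_pos h, paddedReverse, if_pos h, labelPf, labels, map_range_part]
  · have hn := add_length_paddedReverse mu lam.length
    rw [paddedReverse, if_neg h] at hn
    rw [paddedParts, if_neg h, paddedReverse, if_neg h, ← labelPf_succ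
      (by rw [← hn, List.length_cons]; ring) (fun i hi => (lam.part_pos_iff i).2 hi)
      (lam.part_of_ge le_rfl) mu.pos_of_mem_reverse, labelPf, labels_succ, map_range_part,
      lam.part_of_ge le_rfl]
    simp

end StrictPartition

theorem mainTheorem5 (lam mu : StrictPartition)
    (hsub : mu.shiftedDiagram ⊆ lam.shiftedDiagram) :
    (lam.skewDim mu : ℚ) = ((lam.size - mu.size)! : ℚ) * pfaffian (lam.matA mu) := by
  have hle := StrictPartition.part_le_of_subset hsub
  have hlen : mu.length ≤ lam.length := by
    by_contra! h
    have h1 := (mu.part_pos_iff _).2 h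
    have h2 := hle lam.length
    rw [lam.part_of_ge le_rfl] at h2
    omega
  have hsize : mu.size ≤ lam.size := by
    rw [← mu.sum_part hlen, ← lam.sum_part le_rfl]
    exact Finset.sum_le_sum fun i _ => hle i
  rw [StrictPartition.skewDim_eq, StrictPartition.skewDiagram_eq, StrictPartition.pfaffian_matA]
  refine mu.ncard_standardFillings_skewCells lam.part_succ_le lam.part_pos_iff hle ?_
  rw [lam.sum_part le_rfl]
  omega
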